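/- Let $H$ be a real separable Hilbert space, $a<b$, and let $\mathcal A=\{A_\lambda\colon\mathcal D\subset H\to H;\ \lambda\in[a,b]\}$ be a family of (unbounded) self-adjoint Fredholm operators with a fixed domain $\mathcal D$ such that $0$ is not in the spectrum of $A_a$ nor of $A_b$. Let $H_2$ be the Hilbert space $\mathcal D$ with the graph inner product $\langle u,v\rangle+\langle A_a u,A_a v\rangle$, and assume that $\lambda\mapsto A_\lambda$ is a $C^1$ map from $[a,b]$ to $\mathcal L(H_2;H)$ with the operator norm. Let $\Sigma(\mathcal A)=\{\lambda\in[a,b]:\ker A_\lambda\neq 0\}$, let $\lambda_*\in\Sigma(\mathcal A)$, and let $Q(\mathcal A,\lambda_*)(h)=\langle\dot A_{\lambda_*}h,h\rangle$, $h\in\ker A_{\lambda_*}$, be the crossing form, where the dot is the derivative with respect to $\lambda$. If $Q(\mathcal A,\lambda_*)$ is nondegenerate, then $\lambda_*$ is an isolated point of $\Sigma(\mathcal A)$, the spectral flow $\mathrm{sf}(\mathcal A,[\lambda_*-\epsilon,\lambda_*+\epsilon])$ is well defined for all small $\epsilon>0$, and $$\lim_{\epsilon\to0^+}\mathrm{sf}(\mathcal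 A,[\lambda_*-\epsilon,\lambda_*+\epsilon])=\mathrm{sign}\,Q(\mathcal A,\lambda_*).$$ Here the spectral flow $\mathrm{sf}(\mathcal A,[c,d])$, when $A_c$ and $A_d$ are injective, is the generalized Maslov index, relative to $H\times\{0\}$, of the path of graphs $L(\lambda)=\mathrm{Gr}\,A_\lambda$, $\lambda\in[c,d]$, a path continuous in the gap metric of Lagrangian subspaces of $H\times H$ with the symplectic form $\omega((u_1,v_1),(u_2,v_2))=\langle v_2,u_1\rangle-\langle v_1,u_2\rangle$. It is defined as follows. Choose a closed subspace $I\subset H$ of finite codimension such that, for all $\lambda\in[c,d]$, $L(\lambda)\cap(I\times\{0\})=0$ and $L(\lambda)+I\times\{0\}$ is closed; put $F=I^\perp$, let $P_F$ be the orthogonal projector onto $F$, and let $l(\lambda)=\{(P_Fx,y):(x,y)\in L(\lambda),\ y\in F\}$, a Lagrangian subspace of $F\times F$. Extend $l$ to a closed path $\bar l$ by a path from $l(d)$ to $l(c)$ in the set of Lagrangian subspaces transverse to $F\times\{0\}$. The index is the winding number of $\det^2(\bar l)$, where, with $F\times F\cong\mathbb C^n$ by $(x,y)\mapsto x+iy$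 and an orthonormal basis of $F$, $\det^2(M)=\det(U)^2$ for any $U\in U(n)$ with $U(\mathbb R^n)=M$. It does not depend on the choices. -/

import Mathlib

open Set Filter Topology

noncomputable section

namespace SpecFlow

/-! ### The canonical symplectic Hilbert space of a real Hilbert space -/

section Symplectic

variable {E : Type*} [NormedAddCommGroup E] [InnerProductSpace ℝ E]

/-- The Hilbert space `S(E) = E × E`, with the Hilbert sum inner product. -/
abbrev SympSpace (E : Type*) : Type _ := WithLp 2 (E × E)

/-- The canonical symplectic form `ω((u₁,v₁),(u₂,v₂)) = ⟨v₂,u₁⟩ - ⟨v₁,u₂⟩`; equivalently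
`ω(z,w) = ⟨J z, w⟩` with `J(u,v) = (-v,u)`. -/
def omega (z w : SympSpace E) : ℝ := inner ℝ w.snd z.fst - inner ℝ z.snd w.fst

/-- The orthogonal `W♯` of `W` with respect to the symplectic form. -/
def sympOrth (W : Submodule ℝ (SympSpace E)) : Submodule ℝ (SympSpace E) where
  carrier := {v | ∀ u ∈ W, omega u v = 0}
  zero_mem' := by
    intro u _
    simp [omega]
  add_mem' := by
    intro v w hv hw u hu
    have h1 := hv u hu
    have h2 := hw u hu
    simp only [omega, WithLp.add_fst, WithLp.add_snd, inner_add_left, inner_add_right] at *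
    linarith
  smul_mem' := by
    intro c v hv u hu
    have h1 := hv u hu
    simp only [omega, WithLp.smul_fst, WithLp.smul_snd, real_inner_smul_left,
      real_inner_smul_right] at *
    rw [← mul_sub, h1, mul_zero]

/-- `L` is a (closed) Lagrangian subspace of `S(E)`: `L = L♯`. -/
def IsLagrangian (L : Submodule ℝ (SympSpace E)) : Prop :=
  IsClosed (L : Set (SympSpace E)) ∧ sympOrth L = L

/-- The subspace `I × {0}` of `S(E)`. -/
def horizontal (I : Submodule ℝ E) : Submodule ℝ (SympSpace E) :=
  I.comap (WithLp.fstₗ 2 ℝ E E) ⊓ LinearMap.ker (WithLp.sndₗ 2 ℝ E E)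

/-- `V` and `W` form a Fredholm pair: `V + W` is closed, and `V ∩ W` and `S(E)/(V + W)` have finite
dimension. -/
def IsFredholmPair (V W : Submodule ℝ (SympSpace E)) : Prop :=
  IsClosed ((V ⊔ W : Submodule ℝ (SympSpace E)) : Set (SympSpace E)) ∧
    FiniteDimensional ℝ (V ⊓ W : Submodule ℝ (SympSpace E)) ∧
    FiniteDimensional ℝ (SympSpace E ⧸ (V ⊔ W))

/-- `V` and `W` have a clean intersection: `V ∩ W = 0` and `V + W` is closed. -/
def IsClean (V W : Submodule ℝ (SympSpace E)) : Prop :=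
  V ⊓ W = ⊥ ∧ IsClosed ((V ⊔ W : Submodule ℝ (SympSpace E)) : Set (SympSpace E))

/-- Continuity on `s`, with respect to the gap metric `d(V, W) = ‖P_V - P_W‖`, of a family of
closed subspaces. (Taking the closure changes nothing for closed subspaces; it makes the orthogonal
projector `P_V` available for every subspace `V`.) -/
def GapContinuousOn [CompleteSpace E] (l : ℝ → Submodule ℝ (SympSpace E)) (s : Set ℝ) : Prop :=
  ContinuousOn (fun t => (l t).topologicalClosure.starProjection) s

end Symplectic

/-! ### The Maslov index in finite dimension -/

section Maslov

variable {F : Type*} [NormedAddCommGroup F] [InnerProductSpace ℝ F]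

/-- The matrix of the complex linear map `ℂⁿ → F × F ≅ ℂⁿ` sending the canonical basis to the
vectors `u k`. Here `F` is identified with `ℝⁿ` by the orthonormal basis `b`, and `F × F` with `ℂⁿ`
by `(x, y) ↦ x + i y`. It is unitary when `u` is an orthonormal basis of a Lagrangian subspace. -/
def frameMatrix {n : ℕ} (b : OrthonormalBasis (Fin n) ℝ F) (u : Fin n → SympSpace F) :
    Matrix (Fin n) (Fin n) ℂ :=
  Matrix.of fun j k =>
    ((inner ℝ (b j) (u k).fst : ℝ) : ℂ) + Complex.I * ((inner ℝ (b j) (u k).snd : ℝ) : ℂ)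

/-- `z` is the value at the Lagrangian subspace `L` of the squared determinant
`Λ(n) = U(n)/O(n) → S¹`: `z = det(U)²` for a unitary `U` sending `ℝⁿ` onto `L`. -/
def IsSqDet (L : Submodule ℝ (SympSpace F)) (z : ℂ) : Prop :=
  ∃ (n : ℕ) (b : OrthonormalBasis (Fin n) ℝ F) (u : OrthonormalBasis (Fin n) ℝ L),
    z = (frameMatrix b fun k => (u k : SympSpace F)).det ^ 2

/-- The closed path `l` of Lagrangian subspaces on `[a, b]` has Maslov index `m`: the winding number
of its squared determinant is `m`. -/
def HasLoopMaslovIndex (l : ℝ → Submodule ℝ (SympSpace F)) (a b : ℝ) (m : ℤ) : Prop :=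
  ∃ θ : ℝ → ℝ, ContinuousOn θ (Icc a b) ∧
    (∀ t ∈ Icc a b, IsSqDet (l t) (Complex.exp (Complex.I * (θ t : ℂ)))) ∧
    θ b - θ a = 2 * Real.pi * m

/-- The path `l` of Lagrangian subspaces of `S(F)` on `[a, b]` has Maslov index `m` relative to
`F₀ = F × {0}`: its extension `l'` to a closed path, by a path in the set of Lagrangian subspaces
transverse to `F₀` (parametrized by `[b, b + 1]`), has Maslov index `m`. -/
def HasMaslovIndex [CompleteSpace F] (l : ℝ → Submodule ℝ (SympSpace F)) (a b : ℝ) (m : ℤ) : Prop :=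
  ∃ l' : ℝ → Submodule ℝ (SympSpace F),
    GapContinuousOn l' (Icc a (b + 1)) ∧
    (∀ t ∈ Icc a (b + 1), IsLagrangian (l' t)) ∧
    (∀ t ∈ Icc a b, l' t = l t) ∧
    (∀ t ∈ Icc b (b + 1), IsCompl (l' t) (horizontal ⊤)) ∧
    l' (b + 1) = l a ∧
    HasLoopMaslovIndex l' a (b + 1) m

end Maslov

/-! ### Symplectic reduction and the generalized Maslov index -/

section Generalized

variable {H : Type*} [NormedAddCommGroup H] [InnerProductSpace ℝ H] [CompleteSpace H]

/-- For `F = Iᗮ`, the orthogonal projection of `S(H)` onto `S(F) = F × F`, which is the symplectic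
reduction `I₀♯ ∩ I₀ᗮ` of `S(H)` modulo `I₀ = I × {0}`. -/
def reductionProj (I : Submodule ℝ H) : SympSpace H →ₗ[ℝ] SympSpace Iᗮ :=
  (WithLp.linearEquiv 2 ℝ (Iᗮ × Iᗮ)).symm.toLinearMap ∘ₗ
    ((Iᗮ.orthogonalProjectionOnto : H →ₗ[ℝ] Iᗮ).prodMap
      (Iᗮ.orthogonalProjectionOnto : H →ₗ[ℝ] Iᗮ)) ∘ₗ
    (WithLp.linearEquiv 2 ℝ (H × H)).toLinearMap

/-- The symplectic reduction of `L` modulo `I₀ = I × {0}`: the image of `L ∩ I₀♯` by the orthogonal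
projection onto the reduction of `S(H)`. -/
def reduction (I : Submodule ℝ H) (L : Submodule ℝ (SympSpace H)) :
    Submodule ℝ (SympSpace Iᗮ) :=
  (L ⊓ sympOrth (horizontal I)).map (reductionProj I)

/-- `L` is on `[a, b]` a continuous path in the Fredholm Lagrangian Grassmannian of `S(H)`, with
endpoints transverse to `H₀ = H × {0}`. -/
structure IsAdmissibleLagrangianPath (L : ℝ → Submodule ℝ (SympSpace H)) (a b : ℝ) : Prop where
  le : a ≤ b
  isLagrangian : ∀ t ∈ Icc a b, IsLagrangian (L t)
  isFredholmPair : ∀ t ∈ Icc a b, IsFredholmPair (horizontal ⊤) (L t)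
  gapContinuousOn : GapContinuousOn L (Icc a b)
  transverse_left : IsCompl (L a) (horizontal ⊤)
  transverse_right : IsCompl (L b) (horizontal ⊤)

/-- The admissible path `L` on `[a, b]` has generalized Maslov index `m` relative to
`H₀ = H × {0}`: for some closed subspace `I` of finite codimension with `I × {0}` clean with respect
to all `L t`, the reduction modulo `I × {0}` has Maslov index `m`. -/
def HasGeneralizedMaslovIndex (L : ℝ → Submodule ℝ (SympSpace H)) (a b : ℝ) (m : ℤ) : Prop :=
  IsAdmissibleLagrangianPath L a b ∧
    ∃ I : Submodule ℝ H, IsClosed (I : Set H) ∧ FiniteDimensional ℝ (H ⧸ I) ∧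
      (∀ t ∈ Icc a b, IsClean (L t) (horizontal I)) ∧
      HasMaslovIndex (fun t => reduction I (L t)) a b m

end Generalized

/-! ### Unbounded operators and the spectral flow -/

section Operators

variable {H : Type*} [NormedAddCommGroup H] [InnerProductSpace ℝ H]

/-- The graph of an unbounded operator, as a subspace of `S(H)`. -/
def graphS (T : H →ₗ.[ℝ] H) : Submodule ℝ (SympSpace H) :=
  T.graph.comap (WithLp.linearEquiv 2 ℝ (H × H)).toLinearMap

/-- `T` is Fredholm: the kernel and the cokernel have finite dimension and the range is closed. -/
def IsFredholmOp (T : H →ₗ.[ℝ] H) : Prop :=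
  FiniteDimensional ℝ (LinearMap.ker T.toFun) ∧
    FiniteDimensional ℝ (H ⧸ LinearMap.range T.toFun) ∧
    IsClosed (LinearMap.range T.toFun : Set H)

/-- `0` is not in the spectrum of `T`: there is a bounded inverse `R : H → dom T` of `T`. -/
def HasBoundedInverse (T : H →ₗ.[ℝ] H) : Prop :=
  ∃ R : H →L[ℝ] H, (∀ u : T.domain, R (T u) = u) ∧ ∀ v : H, ∃ u : T.domain, (u : H) = R v ∧ T u = v

/-- The path `T` of unbounded self-adjoint Fredholm operators has spectral flow `m` on `[c, d]`: the
path of the graphs has generalized Maslov index `m`. -/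
def HasSpectralFlow [CompleteSpace H] (T : ℝ → (H →ₗ.[ℝ] H)) (c d : ℝ) (m : ℤ) : Prop :=
  HasGeneralizedMaslovIndex (fun t => graphS (T t)) c d m

open Classical in
/-- The spectral flow of the path `T` on `[c, d]` (with the value `0` for a path that has none). -/
def spectralFlow [CompleteSpace H] (T : ℝ → (H →ₗ.[ℝ] H)) (c d : ℝ) : ℤ :=
  if h : ∃ m, HasSpectralFlow T c d m then h.choose else 0

/-- The domain of an unbounded operator `T₀`, to be normed by the graph norm of `T₀`. -/
def GraphDomain (T₀ : H →ₗ.[ℝ] H) : Type _ := T₀.domain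

instance (T₀ : H →ₗ.[ℝ] H) : AddCommGroup (GraphDomain T₀) :=
  inferInstanceAs (AddCommGroup T₀.domain)

instance (T₀ : H →ₗ.[ℝ] H) : Module ℝ (GraphDomain T₀) :=
  inferInstanceAs (Module ℝ T₀.domain)

/-- The embedding `u ↦ (u, T₀ u)` of the domain in `S(H)`. -/
def graphEmb (T₀ : H →ₗ.[ℝ] H) : GraphDomain T₀ →ₗ[ℝ] SympSpace H :=
  (WithLp.linearEquiv 2 ℝ (H × H)).symm.toLinearMap ∘ₗ
    (LinearMap.prod T₀.domain.subtype T₀.toFun : T₀.domain →ₗ[ℝ] H × H)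

theorem graphEmb_injective (T₀ : H →ₗ.[ℝ] H) : Function.Injective (graphEmb T₀) := by
  intro u v huv
  exact Subtype.ext (congrArg WithLp.fst huv)

/-- The graph norm `‖u‖² = ‖u‖² + ‖T₀ u‖²`. -/
instance (T₀ : H →ₗ.[ℝ] H) : NormedAddCommGroup (GraphDomain T₀) :=
  NormedAddCommGroup.induced _ _ (graphEmb T₀) (graphEmb_injective T₀)

/-- The graph inner product `⟨u, v⟩ + ⟨T₀ u, T₀ v⟩`. -/
instance (T₀ : H →ₗ.[ℝ] H) : InnerProductSpace ℝ (GraphDomain T₀) where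
  __ := NormedSpace.induced ℝ (GraphDomain T₀) (SympSpace H) (graphEmb T₀)
  inner u v := inner ℝ (graphEmb T₀ u) (graphEmb T₀ v)
  norm_sq_eq_re_inner u := norm_sq_eq_re_inner (𝕜 := ℝ) (graphEmb T₀ u)
  conj_inner_symm u v := inner_conj_symm (𝕜 := ℝ) _ _
  add_left u v w := by rw [map_add, inner_add_left]
  smul_left u v r := by rw [map_smul, inner_smul_left]

/-- The tautological identification of the domain with the domain normed by the graph norm. -/
def toGraphDomain (T₀ : H →ₗ.[ℝ] H) : T₀.domain →ₗ[ℝ] GraphDomain T₀ where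
  toFun u := u
  map_add' _ _ := rfl
  map_smul' _ _ := rfl

/-- The inclusion of the domain, normed by the graph norm, in `H`. -/
def graphIncl (T₀ : H →ₗ.[ℝ] H) : GraphDomain T₀ →ₗ[ℝ] H :=
  (T₀.domain.subtype : T₀.domain →ₗ[ℝ] H)

/-- A bounded operator `B : H₂ → H`, seen as an unbounded operator in `H` with domain `H₂`. -/
def toUnbounded {T₀ : H →ₗ.[ℝ] H} (B : GraphDomain T₀ →L[ℝ] H) : H →ₗ.[ℝ] H where
  domain := T₀.domain
  toFun := (B : GraphDomain T₀ →ₗ[ℝ] H) ∘ₗ toGraphDomain T₀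

/-- `A` is an admissible path in `L(H₂; H)` on `[a, b]`: a norm continuous path of bounded
operators `A t : H₂ → H` that are self-adjoint Fredholm operators in `H` with domain `H₂`, with
`0` not in the spectrum of `A a` and of `A b`. Here `H₂` carries the graph norm of `T₀ = A a`. -/
structure IsAdmissiblePath (T₀ : H →ₗ.[ℝ] H) [CompleteSpace H] (A : ℝ → (GraphDomain T₀ →L[ℝ] H))
    (a b : ℝ) : Prop where
  lt : a < b
  initial : toUnbounded (A a) = T₀
  isSelfAdjoint : ∀ t ∈ Icc a b, IsSelfAdjoint (toUnbounded (A t))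
  isFredholm : ∀ t ∈ Icc a b, IsFredholmOp (toUnbounded (A t))
  continuousOn : ContinuousOn A (Icc a b)
  inverse_left : HasBoundedInverse (toUnbounded (A a))
  inverse_right : HasBoundedInverse (toUnbounded (A b))

/-- The kernel of `A t`. -/
def kernel {T₀ : H →ₗ.[ℝ] H} (B : GraphDomain T₀ →L[ℝ] H) : Submodule ℝ (GraphDomain T₀) :=
  LinearMap.ker (B : GraphDomain T₀ →ₗ[ℝ] H)

/-- The singular set `{t ∈ [a, b] : ker (A t) ≠ 0}`. -/
def singularSet {T₀ : H →ₗ.[ℝ] H} (A : ℝ → (GraphDomain T₀ →L[ℝ] H)) (a b : ℝ) : Set ℝ :=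
  {t | t ∈ Icc a b ∧ kernel (A t) ≠ ⊥}

/-- The quadratic form `h ↦ ⟨B h, h⟩` on a subspace `K` of `H₂`. -/
def quadForm {T₀ : H →ₗ.[ℝ] H} (B : GraphDomain T₀ →L[ℝ] H) (K : Submodule ℝ (GraphDomain T₀)) :
    QuadraticForm ℝ K :=
  LinearMap.BilinMap.toQuadraticMap
    (LinearMap.mk₂ ℝ (fun h k : K => inner ℝ (B (h : GraphDomain T₀)) (graphIncl T₀ k))
      (fun _ _ _ => by simp [inner_add_left]) (fun _ _ _ => by simp [real_inner_smul_left])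
      (fun _ _ _ => by simp [inner_add_right]) (fun _ _ _ => by simp [real_inner_smul_right]))

/-- The crossing form `h ↦ ⟨A'(t) h, h⟩` on `ker (A t)` of a `C¹` path on `[a, b]`. -/
def crossingForm {T₀ : H →ₗ.[ℝ] H} (A : ℝ → (GraphDomain T₀ →L[ℝ] H)) (a b t : ℝ) :
    QuadraticForm ℝ (kernel (A t)) :=
  quadForm (derivWithin A (Icc a b) t) (kernel (A t))

/-- A quadratic form is nondegenerate: so is its polar form. -/
def IsNondegenerate {V : Type*} [AddCommGroup V] [Module ℝ V] (Q : QuadraticForm ℝ V) : Prop :=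
  Q.polarBilin.SeparatingLeft

/-- The signature: the maximal dimension of a positive definite subspace minus that of a negative
definite one. -/
def signature {V : Type*} [AddCommGroup V] [Module ℝ V] (Q : QuadraticForm ℝ V) : ℤ :=
  (sigPos Q : ℤ) - (sigNeg Q : ℤ)

end Operators

end SpecFlow

end

/-! Write `A` for the path, `s` for the crossing, `F = Iᗮ` for the finite-dimensional space of a
reduction and `P` for the projector onto `F`. If `κ` is such that `M = A t - κ P` is invertible, a
point `(u, A u)` of the graph with `A u ∈ F` is determined by `w = M u ∈ F`. With the symmetric
operator `T = P M⁻¹` on `F`, the reduced Lagrangian is then `{(T w, w + κ T w)}`, that is `chart κ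
T` (`reduction_graphS`). Where `A t` is itself invertible, `κ = 0` is allowed, and the charts with
`κ = 0` are exactly the Lagrangians transverse to `F × 0`. The closing path therefore lives in that
chart.

In a fixed chart the squared determinant has a global continuous argument `phase κ T`, a sum over
the eigenvalues of `T`. When one Lagrangian lies in the charts `κ > 0` and `0`, the two arguments
differ by `2π` times the negative index of `1 + κ T` (`phase_zero_eq`). Around the closed path the
`phase 0` terms cancel, and the winding number is the variation across `s` of the negative index of
`1 + κ T` (`HasMaslovIndex.eq_sigNeg_sub`).

The kernel of `1 + κ T` at `s` is `P (ker (A s))`, and there the derivative `κ T'` is `-κ⁻¹` times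
the crossing form `Q`. If `Q` is nondegenerate, the negative index is `N + sigPos Q` just after `s`
and `N + sigNeg Q` just before, with `N` its value at `s`; moreover `1 + κ T`, hence `A t`, is
injective for `t ≠ s` near `s` (`eventually_sigNeg_compression`). The jump is the signature.

Uniqueness must cover every admissible `I`: cleanness at `s` alone provides a suitable `κ > 0`
(`exists_pos_injective_pert`). For existence, `F = ker (A s)` and `κ = 1` suffice. -/

noncomputable section

set_option linter.unusedSectionVars false

namespace SpecFlow

/-! ### Continuity of symmetric functions of the eigenvalues -/

section EigSum

variable {F : Type*} [NormedAddCommGroup F] [InnerProductSpace ℝ F] [FiniteDimensional ℝ F]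

/-- The sum of the values of `f` at the eigenvalues of `T`, counted with multiplicity. -/
def eigSum (f : ℝ → ℝ) (T : F →L[ℝ] F) : ℝ :=
  ((T : F →ₗ[ℝ] F).charpoly.roots.map f).sum

theorem toMatrix_eq_diagonal {ι : Type*} [Fintype ι] [DecidableEq ι] (e : Module.Basis ι ℝ F)
    {T : F →ₗ[ℝ] F} {τ : ι → ℝ} (h : ∀ j, T (e j) = τ j • e j) :
    LinearMap.toMatrix e e T = Matrix.diagonal τ := by
  ext i j
  rw [LinearMap.toMatrix_apply, h, map_smul, Finsupp.smul_apply, Module.Basis.repr_self,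
    Finsupp.single_apply, Matrix.diagonal_apply]
  by_cases hij : i = j
  · simp [hij]
  · simp [hij, Ne.symm hij]

theorem eigSum_eq {ι : Type*} [Fintype ι] (e : Module.Basis ι ℝ F) (f : ℝ → ℝ)
    {T : F →L[ℝ] F} {τ : ι → ℝ} (h : ∀ j, T (e j) = τ j • e j) :
    eigSum f T = ∑ j, f (τ j) := by
  classical
  rw [eigSum, ← LinearMap.charpoly_toMatrix _ e, toMatrix_eq_diagonal e (τ := τ) h,
    Matrix.charpoly_diagonal]
  have : (∏ i, (Polynomial.X - Polynomial.C (τ i))) =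
      ((Finset.univ.val.map τ).map fun a => Polynomial.X - Polynomial.C a).prod := by
    rw [Multiset.map_map]; rfl
  rw [this, Polynomial.roots_multiset_prod_X_sub_C, Multiset.map_map]
  rfl

theorem exists_eigenbasis {T : F →L[ℝ] F} (hT : (T : F →ₗ[ℝ] F).IsSymmetric) :
    ∃ (e : OrthonormalBasis (Fin (Module.finrank ℝ F)) ℝ F)
      (τ : Fin (Module.finrank ℝ F) → ℝ), ∀ j, T (e j) = τ j • e j :=
  ⟨hT.eigenvectorBasis rfl, hT.eigenvalues rfl, fun j => hT.apply_eigenvectorBasis rfl j⟩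

theorem aeval_apply_eigenvector {T : F →L[ℝ] F} {v : F} {τ : ℝ} (h : T v = τ • v)
    (p : Polynomial ℝ) : Polynomial.aeval T p v = p.eval τ • v := by
  induction p using Polynomial.induction_on' with
  | add p q hp hq => simp [hp, hq, add_smul]
  | monomial n a =>
    have : ∀ n : ℕ, (T ^ n) v = τ ^ n • v := by
      intro n
      induction n with
      | zero => simp
      | succ n ih => rw [pow_succ', mul_apply_eq_comp, ih, map_smul, h, smul_smul,
          pow_succ]
    rw [Polynomial.aeval_monomial, mul_apply_eq_comp, this,
      Polynomial.eval_monomial, Algebra.algebraMap_eq_smul_one, smul_apply,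
      one_apply_eq_self, smul_smul]

theorem eigSum_polynomial {T : F →L[ℝ] F} (hT : (T : F →ₗ[ℝ] F).IsSymmetric)
    (p : Polynomial ℝ) :
    eigSum (fun x => p.eval x) T =
      LinearMap.trace ℝ F (Polynomial.aeval T p : F →L[ℝ] F).toLinearMap := by
  obtain ⟨e, τ, h⟩ := exists_eigenbasis hT
  rw [eigSum_eq e.toBasis _ (τ := τ) (by simpa using h),
    LinearMap.trace_eq_matrix_trace ℝ e.toBasis,
    toMatrix_eq_diagonal e.toBasis (τ := fun j => p.eval (τ j))
      (fun j => by simpa using aeval_apply_eigenvector (h j) p), Matrix.trace_diagonal]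

theorem continuous_eigSum_polynomial (p : Polynomial ℝ) :
    Continuous fun T : F →L[ℝ] F =>
      LinearMap.trace ℝ F (Polynomial.aeval T p : F →L[ℝ] F).toLinearMap := by
  have h1 : Continuous fun T : F →L[ℝ] F => Polynomial.aeval T p := Polynomial.continuous_aeval p
  let tr : (F →L[ℝ] F) →ₗ[ℝ] ℝ := LinearMap.trace ℝ F ∘ₗ ContinuousLinearMap.coeLM ℝ
  have h2 : Continuous tr := LinearMap.continuous_of_finiteDimensional tr
  exact h2.comp h1

theorem abs_eigenvalue_le {T : F →L[ℝ] F} {v : F} {τ : ℝ} (hv : ‖v‖ = 1) (h : T v = τ • v) :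
    |τ| ≤ ‖T‖ := by
  have := T.le_opNorm v
  rwa [h, norm_smul, hv, mul_one, mul_one, Real.norm_eq_abs] at this

/-- No continuous labelling of the eigenvalues is needed. For a polynomial `p` the sum is the trace
of `p(T)`, which is continuous in `T`; the general case follows by Weierstrass approximation on an
interval containing the spectra of all nearby operators. -/
theorem continuousOn_eigSum {f : ℝ → ℝ} (hf : Continuous f) {X : Type*} [TopologicalSpace X]
    {T : X → (F →L[ℝ] F)} {s : Set X} (hT : ContinuousOn T s)
    (hs : ∀ t ∈ s, (T t : F →ₗ[ℝ] F).IsSymmetric) :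
    ContinuousOn (fun t => eigSum f (T t)) s := by
  intro t₀ ht₀
  rw [ContinuousWithinAt, Metric.tendsto_nhds]
  intro ε hε
  set n := Module.finrank ℝ F
  set R := ‖T t₀‖ + 1
  have hn : (0 : ℝ) < 3 * (n + 1) := by positivity
  -- There are `n` eigenvalues, so this tolerance gives a total error of at most `ε / 3`; the `+ 1`
  -- covers dimension zero.
  obtain ⟨p, hp⟩ := exists_polynomial_near_of_continuousOn (-R) R f hf.continuousOn
    (ε / (3 * (n + 1))) (by positivity)
  have key : ∀ t ∈ s, ‖T t‖ ≤ R →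
      |eigSum f (T t) - eigSum (fun x => p.eval x) (T t)| ≤ ε / 3 := by
    intro t ht htR
    obtain ⟨e, τ, h⟩ := exists_eigenbasis (hs t ht)
    rw [eigSum_eq e.toBasis f (τ := τ) (by simpa using h),
      eigSum_eq e.toBasis _ (τ := τ) (by simpa using h), ← Finset.sum_sub_distrib]
    refine (Finset.abs_sum_le_sum_abs _ _).trans ?_
    have hb : ∀ j ∈ Finset.univ, |f (τ j) - p.eval (τ j)| ≤ ε / (3 * (n + 1)) := by
      intro j _
      have h1 := (abs_eigenvalue_le (e.orthonormal.1 j) (h j)).trans htR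
      rw [abs_sub_comm]
      exact (hp _ (abs_le.1 h1)).le
    refine (Finset.sum_le_sum hb).trans ?_
    rw [Finset.sum_const, Finset.card_univ, Fintype.card_fin, nsmul_eq_mul]
    rw [mul_div_assoc', div_le_div_iff₀ hn (by norm_num)]
    change (n : ℝ) * ε * 3 ≤ _
    nlinarith
  have hcont : ContinuousWithinAt (fun t => eigSum (fun x => p.eval x) (T t)) s t₀ := by
    have := ((continuous_eigSum_polynomial (F := F) p).comp_continuousOn hT) t₀ ht₀
    exact this.congr (fun t ht => eigSum_polynomial (hs t ht) p) (eigSum_polynomial (hs t₀ ht₀) p)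
  have h2 := (Metric.tendsto_nhds.1 hcont) (ε / 3) (by positivity)
  have h3 : ∀ᶠ t in 𝓝[s] t₀, ‖T t‖ < R :=
    (hT t₀ ht₀).norm.eventually (gt_mem_nhds (lt_add_one _))
  filter_upwards [h2, h3, self_mem_nhdsWithin] with t h2 h3 ht
  have h4 := key t ht h3.le
  have h5 := key t₀ ht₀ (lt_add_one _).le
  rw [Real.dist_eq] at h2 ⊢
  rw [abs_lt] at h2 ⊢
  rw [abs_le] at h4 h5
  constructor <;> linarith [h2.1, h2.2, h4.1, h4.2, h5.1, h5.2]

end EigSum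

/-! ### Gap continuity of ranges -/

section Gap

theorem continuousOn_ringInverse {R X : Type*} [NormedRing R] [HasSummableGeomSeries R]
    [TopologicalSpace X] {f : X → R} {s : Set X} (hf : ContinuousOn f s)
    (h : ∀ t ∈ s, IsUnit (f t)) : ContinuousOn (fun t => Ring.inverse (f t)) s := by
  intro t ht
  have h1 : ContinuousAt Ring.inverse (f t) := by
    obtain ⟨x, hx⟩ := h t ht
    rw [← hx]
    exact NormedRing.inverse_continuousAt x
  exact h1.comp_continuousWithinAt (hf t ht)

variable {V Y : Type*} [NormedAddCommGroup V] [InnerProductSpace ℝ V] [CompleteSpace V]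
  [NormedAddCommGroup Y] [InnerProductSpace ℝ Y] [CompleteSpace Y]

theorem isUnit_adjoint_comp_self {S : V →L[ℝ] Y} (hS : ∃ K, AntilipschitzWith K S) :
    IsUnit (S.adjoint ∘L S) := by
  obtain ⟨K, hK⟩ := hS
  -- `K + 1` replaces `K`, which may vanish, so that the coercivity constant is positive.
  have hpos : (0 : NNReal) < ((K + 1) ^ 2)⁻¹ := by positivity
  refine ContinuousLinearMap.isUnit_of_forall_le_norm_inner_map _ hpos fun x => ?_
  rw [ContinuousLinearMap.comp_apply, ContinuousLinearMap.adjoint_inner_left,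
    real_inner_self_eq_norm_sq, norm_pow, norm_norm]
  have h1 : ‖x‖ ≤ K * ‖S x‖ := by
    have := hK.le_mul_dist x 0
    simpa using this
  have h2 : ‖x‖ ≤ (K + 1) * ‖S x‖ := by nlinarith [norm_nonneg (S x)]
  have h3 : (0 : ℝ) < K + 1 := by positivity
  push_cast
  rw [← div_eq_mul_inv, div_le_iff₀ (by positivity)]
  calc ‖x‖ ^ 2 ≤ ((K + 1) * ‖S x‖) ^ 2 := by gcongr
    _ = _ := by ring

/-- These are the normal equations of least squares. Since `S* S` is coercive, hence invertible, the
formula exhibits the projector as a continuous function of `S`. -/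
theorem starProjection_range_eq {S : V →L[ℝ] Y} (hS : ∃ K, AntilipschitzWith K S) :
    (LinearMap.range (S : V →ₗ[ℝ] Y)).topologicalClosure.starProjection =
      S ∘L Ring.inverse (S.adjoint ∘L S) ∘L S.adjoint := by
  have hu := isUnit_adjoint_comp_self hS
  ext u
  refine Submodule.eq_starProjection_of_mem_of_inner_eq_zero ?_ ?_
  · exact Submodule.le_topologicalClosure _ ⟨_, rfl⟩
  · intro w hw
    have hcl : IsClosed {w : Y |
        inner ℝ (u - (S ∘L Ring.inverse (S.adjoint ∘L S) ∘L S.adjoint) u) w = 0} :=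
      isClosed_eq (by fun_prop) continuous_const
    refine closure_minimal ?_ hcl hw
    rintro _ ⟨v, rfl⟩
    have h1 : (S.adjoint ∘L S) (Ring.inverse (S.adjoint ∘L S) (S.adjoint u)) = S.adjoint u := by
      have := congrArg (fun A : V →L[ℝ] V => A (S.adjoint u))
        (Ring.mul_inverse_cancel (S.adjoint ∘L S) hu)
      exact this
    simp only [ContinuousLinearMap.coe_comp, Function.comp_apply] at h1
    simp only [ContinuousLinearMap.coe_comp, Function.comp_apply, mem_ofPred_eq,
      ContinuousLinearMap.coe_coe]
    rw [← ContinuousLinearMap.adjoint_inner_left, map_sub, h1, sub_self, inner_zero_left]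

theorem continuousOn_starProjection_range {X : Type*} [TopologicalSpace X] {S : X → (V →L[ℝ] Y)}
    {s : Set X} (hS : ContinuousOn S s) (h : ∀ t ∈ s, ∃ K, AntilipschitzWith K (S t)) :
    ContinuousOn (fun t =>
      (LinearMap.range (S t : V →ₗ[ℝ] Y)).topologicalClosure.starProjection) s := by
  have hadj : ContinuousOn (fun t => (S t).adjoint) s :=
    (ContinuousLinearMap.adjoint (𝕜 := ℝ) (E := V) (F := Y)).continuous.comp_continuousOn hS
  have hc : ContinuousOn (fun t => (S t).adjoint ∘L S t) s := hadj.clm_comp hS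
  have hinv : ContinuousOn (fun t => Ring.inverse ((S t).adjoint ∘L S t)) s :=
    continuousOn_ringInverse hc fun t ht => isUnit_adjoint_comp_self (h t ht)
  exact (hS.clm_comp (hinv.clm_comp hadj)).congr fun t ht => starProjection_range_eq (h t ht)

end Gap

/-! ### Charts of the Lagrangian Grassmannian -/

section Chart

variable {F : Type*} [NormedAddCommGroup F] [InnerProductSpace ℝ F]

/-- The map `w ↦ (T w, w + κ T w)`. -/
def chartMap (κ : ℝ) (T : F →L[ℝ] F) : F →L[ℝ] SympSpace F :=
  ((WithLp.prodContinuousLinearEquiv 2 ℝ F F).symm : F × F →L[ℝ] SympSpace F) ∘L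
    (T.prod (ContinuousLinearMap.id ℝ F + κ • T))

@[simp] theorem chartMap_fst (κ : ℝ) (T : F →L[ℝ] F) (w : F) : (chartMap κ T w).fst = T w := rfl

@[simp] theorem chartMap_snd (κ : ℝ) (T : F →L[ℝ] F) (w : F) :
    (chartMap κ T w).snd = w + κ • T w := rfl

/-- The subspace `{(T w, w + κ T w)}` of `F × F`. -/
def chart (κ : ℝ) (T : F →L[ℝ] F) : Submodule ℝ (SympSpace F) :=
  LinearMap.range (chartMap κ T : F →ₗ[ℝ] SympSpace F)

theorem sympSpace_ext {z w : SympSpace F} (h1 : z.fst = w.fst) (h2 : z.snd = w.snd) : z = w := by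
  refine WithLp.ofLp_injective 2 (Prod.ext h1 h2)

theorem mem_chart {κ : ℝ} {T : F →L[ℝ] F} {z : SympSpace F} :
    z ∈ chart κ T ↔ ∃ w, T w = z.fst ∧ w + κ • T w = z.snd :=
  ⟨fun ⟨w, hw⟩ => ⟨w, by rw [← hw]; exact ⟨rfl, rfl⟩⟩, fun ⟨w, h1, h2⟩ =>
    ⟨w, sympSpace_ext h1 h2⟩⟩

theorem mem_chart' {κ : ℝ} {T : F →L[ℝ] F} {z : SympSpace F} :
    z ∈ chart κ T ↔ T (z.snd - κ • z.fst) = z.fst := by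
  rw [mem_chart]
  constructor
  · rintro ⟨w, h1, h2⟩
    rw [← h2, ← h1, add_sub_cancel_right]
  · intro h
    exact ⟨_, h, by rw [h, sub_add_cancel]⟩

theorem chartMap_injective (κ : ℝ) (T : F →L[ℝ] F) : Function.Injective (chartMap κ T) := by
  intro v w h
  have h1 : T v = T w := congrArg WithLp.fst h
  have h2 : v + κ • T v = w + κ • T w := congrArg WithLp.snd h
  rwa [h1, add_left_inj] at h2

/-- For symmetric `T`, pairing `(T w, w + κ T w)` with `(x, y)` under `ω` gives `⟨w, T (y - κ x) -
x⟩`. This vanishes for all `w` exactly when `(x, y)` lies in the chart. -/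
theorem isLagrangian_chart {κ : ℝ} {T : F →L[ℝ] F} (hT : (T : F →ₗ[ℝ] F).IsSymmetric) :
    IsLagrangian (chart κ T) := by
  constructor
  · have : (chart κ T : Set (SympSpace F)) =
        {z | T (z.snd - κ • z.fst) = z.fst} := by
      ext z; exact mem_chart'
    rw [this]
    have h1 : Continuous fun z : SympSpace F => z.fst := (WithLp.fstL 2 ℝ F F).continuous
    have h2 : Continuous fun z : SympSpace F => z.snd := (WithLp.sndL 2 ℝ F F).continuous
    exact isClosed_eq (by fun_prop) h1
  · ext z
    rw [mem_chart']
    have hs : ∀ v w, inner ℝ (T v) w = inner ℝ v (T w) := hT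
    constructor
    · intro hz
      refine ext_inner_left ℝ fun w => ?_
      have := hz (chartMap κ T w) ⟨w, rfl⟩
      simp only [omega, chartMap_fst, chartMap_snd, inner_add_left, real_inner_smul_left] at this
      rw [← hs, inner_sub_right, real_inner_smul_right, real_inner_comm]
      linarith
    · rintro hz _ ⟨w, rfl⟩
      have := hs w (z.snd - κ • z.fst)
      rw [hz, inner_sub_right, real_inner_smul_right, real_inner_comm] at this
      simp only [omega, ContinuousLinearMap.coe_coe, chartMap_fst, chartMap_snd, inner_add_left,
        real_inner_smul_left]
      linarith

theorem isCompl_chart_zero (T : F →L[ℝ] F) : IsCompl (chart 0 T) (horizontal ⊤) := by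
  have hmem : ∀ z : SympSpace F, z ∈ horizontal (⊤ : Submodule ℝ F) ↔ z.snd = 0 := by
    intro z
    simp [horizontal]
  constructor
  · rw [Submodule.disjoint_def]
    intro z hz hz'
    rw [mem_chart'] at hz
    rw [hmem] at hz'
    refine sympSpace_ext ?_ hz'
    rw [← hz, hz']
    simp
  · rw [codisjoint_iff, eq_top_iff]
    intro z _
    have : z = chartMap 0 T z.snd + (z - chartMap 0 T z.snd) := by abel
    rw [this]
    refine Submodule.add_mem_sup ⟨_, rfl⟩ ((hmem _).2 ?_)
    simp

variable [FiniteDimensional ℝ F]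

theorem gapContinuousOn_chart {κ : ℝ} {T : ℝ → (F →L[ℝ] F)} {s : Set ℝ} (hT : ContinuousOn T s) :
    GapContinuousOn (fun t => chart κ (T t)) s := by
  have hfin : FiniteDimensional ℝ (SympSpace F) := inferInstance
  refine continuousOn_starProjection_range (S := fun t => chartMap κ (T t)) ?_ ?_
  · have h1 : ∀ t, chartMap κ (T t) = chartMap 0 0 +
        (((WithLp.prodContinuousLinearEquiv 2 ℝ F F).symm : F × F →L[ℝ] SympSpace F) ∘L
          ((ContinuousLinearMap.id ℝ F).prod (κ • ContinuousLinearMap.id ℝ F))) ∘L T t :=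
      fun t => ContinuousLinearMap.ext fun w =>
        sympSpace_ext (zero_add _).symm
          (congrArg (· + κ • T t w) (by simp : w = w + (0 : ℝ) • (0 : F →L[ℝ] F) w))
    simp_rw [h1]
    exact continuousOn_const.add (continuousOn_const.clm_comp hT)
  · intro t _
    obtain ⟨K, _, hK⟩ := (LinearMap.injective_iff_antilipschitz
      ((chartMap κ (T t)) : F →ₗ[ℝ] SympSpace F)).1 (chartMap_injective κ (T t))
    exact ⟨K, hK⟩

theorem horizontal_top_mem {z : SympSpace F} :
    z ∈ horizontal (⊤ : Submodule ℝ F) ↔ z.snd = 0 := by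
  simp [horizontal]

/-- A gap continuous path of Lagrangian subspaces transverse to `F × 0` is a continuous path of
graphs of symmetric operators `0 × F → F × 0`. -/
theorem exists_chart_zero_of_isCompl {M : ℝ → Submodule ℝ (SympSpace F)} {s : Set ℝ}
    (hM : GapContinuousOn M s) (hL : ∀ t ∈ s, IsLagrangian (M t))
    (hc : ∀ t ∈ s, IsCompl (M t) (horizontal ⊤)) :
    ∃ S : ℝ → (F →L[ℝ] F), ContinuousOn S s ∧
      (∀ t ∈ s, (S t : F →ₗ[ℝ] F).IsSymmetric) ∧ ∀ t ∈ s, M t = chart 0 (S t) := by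
  have hfin : FiniteDimensional ℝ (SympSpace F) := inferInstance
  set P : ℝ → (SympSpace F →L[ℝ] SympSpace F) :=
    fun t => (M t).topologicalClosure.starProjection with hP
  set j : F →L[ℝ] SympSpace F :=
    ((WithLp.prodContinuousLinearEquiv 2 ℝ F F).symm : F × F →L[ℝ] SympSpace F) ∘L
      ContinuousLinearMap.inr ℝ F F with hj
  have hj2 : ∀ y, (j y).snd = y := fun y => rfl
  -- The vectors `P (0, y)` lie in `M t`, and `D` is their second component. Once `D` is inverted,
  -- they parametrize `M t` by that component, and `S` is their first component.
  set D : ℝ → (F →L[ℝ] F) := fun t => WithLp.sndL 2 ℝ F F ∘L P t ∘L j with hD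
  have hcl : ∀ t ∈ s, (M t).topologicalClosure = M t := fun t ht =>
    (hL t ht).1.submodule_topologicalClosure_eq
  have hPmem : ∀ t ∈ s, ∀ z, P t z ∈ M t := by
    intro t ht z
    have : P t z ∈ (M t).topologicalClosure := Submodule.starProjection_apply_mem _ z
    rwa [hcl t ht] at this
  have hDu : ∀ t ∈ s, IsUnit (D t) := by
    intro t ht
    rw [ContinuousLinearMap.isUnit_iff_bijective]
    -- If `D y = 0`, then `P (0, y)` is orthogonal to `(0, y)`, hence zero, and `(0, y)` is
    -- orthogonal to `M t`. By transversality some vector of `M t` has second component `y`; pairing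
    -- it with `(0, y)` gives `‖y‖² = 0`.
    have hinj : Function.Injective (D t) := by
      rw [injective_iff_map_eq_zero]
      intro y hy
      have h1 : inner ℝ (P t (j y)) (j y) = 0 := by
        rw [WithLp.prod_inner_apply]
        have h3 : (P t (j y)).ofLp.2 = 0 := hy
        have h4 : (j y).ofLp.1 = 0 := rfl
        rw [h3, h4]; simp
      have h2 : P t (j y) = 0 := by
        have h3 := Submodule.inner_starProjection_left_eq_right (M t).topologicalClosure
          (P t (j y)) (j y)
        have h4 : (M t).topologicalClosure.starProjection (P t (j y)) = P t (j y) :=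
          Submodule.starProjection_eq_self_iff.2
            (Submodule.le_topologicalClosure _ (hPmem t ht _))
        rw [h4] at h3
        rw [h1] at h3
        exact inner_self_eq_zero.1 h3.symm
      have h3 : j y ∈ (M t) ⊔ horizontal ⊤ := by
        rw [(hc t ht).sup_eq_top]; trivial
      obtain ⟨m, hm, x, hx, hmx⟩ := Submodule.mem_sup.1 h3
      rw [horizontal_top_mem] at hx
      have h4 : m.snd = y := by
        have := congrArg WithLp.snd hmx
        rwa [WithLp.add_snd, hx, add_zero, hj2] at this
      have h5 : inner ℝ (j y) m = 0 := by
        have h6 := Submodule.starProjection_inner_eq_zero (K := (M t).topologicalClosure)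
          (j y) m (Submodule.le_topologicalClosure _ hm)
        have h7 : (M t).topologicalClosure.starProjection (j y) = 0 := h2
        rwa [h7, sub_zero] at h6
      rw [WithLp.prod_inner_apply] at h5
      have h6 : (j y).ofLp.1 = 0 := rfl
      have h7 : (j y).ofLp.2 = y := rfl
      have h8 : m.ofLp.2 = y := h4
      rw [h6, h7, h8, inner_zero_left, zero_add] at h5
      exact inner_self_eq_zero.1 h5
    exact ⟨hinj, (LinearMap.injective_iff_surjective (f := (D t : F →ₗ[ℝ] F))).1 hinj⟩
  have hDc : ContinuousOn D s := continuousOn_const.clm_comp (hM.clm_comp continuousOn_const)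
  set S : ℝ → (F →L[ℝ] F) :=
    fun t => (WithLp.fstL 2 ℝ F F ∘L P t ∘L j) ∘L Ring.inverse (D t) with hS
  have hSmem : ∀ t ∈ s, ∀ w, chartMap 0 (S t) w ∈ M t := by
    intro t ht w
    have : chartMap 0 (S t) w = P t (j (Ring.inverse (D t) w)) := by
      refine sympSpace_ext rfl ?_
      have h1 := congrArg (fun A : F →L[ℝ] F => A w) (Ring.mul_inverse_cancel _ (hDu t ht))
      have h2 : (P t (j (Ring.inverse (D t) w))).snd = w := h1
      rw [h2]; simp
    rw [this]
    exact hPmem t ht _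
  refine ⟨S, ?_, ?_, ?_⟩
  · have hinv : ContinuousOn (fun t => Ring.inverse (D t)) s := continuousOn_ringInverse hDc hDu
    exact (continuousOn_const.clm_comp (hM.clm_comp continuousOn_const)).clm_comp hinv
  · intro t ht v w
    have h1 := hSmem t ht v
    have h2 := hSmem t ht w
    rw [← (hL t ht).2] at h2
    have := h2 _ h1
    simp only [omega, chartMap_fst, chartMap_snd, zero_smul, add_zero] at this
    simp only [ContinuousLinearMap.coe_coe]
    rw [real_inner_comm]
    linarith
  · intro t ht
    apply le_antisymm
    · intro z hz
      have h1 : z - chartMap 0 (S t) z.snd ∈ M t ⊓ horizontal ⊤ :=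
        ⟨sub_mem hz (hSmem t ht _), horizontal_top_mem.2 (by simp)⟩
      rw [(hc t ht).inf_eq_bot, Submodule.mem_bot, sub_eq_zero] at h1
      exact ⟨z.snd, h1.symm⟩
    · rintro _ ⟨w, rfl⟩
      exact hSmem t ht w

end Chart

/-! ### The squared determinant and its argument in a chart -/

section SqDet

variable {F : Type*} [NormedAddCommGroup F] [InnerProductSpace ℝ F]

theorem sq_det_map_ofReal_toMatrix {ι G : Type*} [Fintype ι] [DecidableEq ι]
    [NormedAddCommGroup G] [InnerProductSpace ℝ G] (a b : OrthonormalBasis ι ℝ G) :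
    ((a.toBasis.toMatrix b).map Complex.ofRealHom).det ^ 2 = 1 := by
  have h := a.det_to_matrix_orthonormalBasis_real b
  rw [Module.Basis.det_apply] at h
  rw [← RingHom.mapMatrix_apply, ← RingHom.map_det, ← map_pow]
  rcases h with h | h <;> rw [h] <;> simp

theorem frameMatrix_change {n : ℕ} {L : Submodule ℝ (SympSpace F)}
    (b b' : OrthonormalBasis (Fin n) ℝ F) (u u' : OrthonormalBasis (Fin n) ℝ L) :
    frameMatrix b' (fun k => (u' k : SympSpace F)) =
      (b'.toBasis.toMatrix b).map Complex.ofRealHom *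
        frameMatrix b (fun k => (u k : SympSpace F)) *
        (u.toBasis.toMatrix u').map Complex.ofRealHom := by
  ext j k
  have h1 : ∀ w : F, ∑ i, inner ℝ (b' j) (b i) * inner ℝ (b i) w = inner ℝ (b' j) w := by
    intro w
    exact b.sum_inner_mul_inner (b' j) w
  have h2 : (u' k : SympSpace F) = ∑ l, inner ℝ (u l) (u' k) • (u l : SympSpace F) := by
    have := congrArg (Submodule.subtype L) (u.sum_repr' (u' k))
    rw [map_sum] at this
    exact this.symm
  have h3 : (u' k : SympSpace F).fst = ∑ l, inner ℝ (u l) (u' k) • (u l : SympSpace F).fst := by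
    have := congrArg (WithLp.fstₗ 2 ℝ F F) h2
    rw [map_sum] at this
    exact this
  have h4 : (u' k : SympSpace F).snd = ∑ l, inner ℝ (u l) (u' k) • (u l : SympSpace F).snd := by
    have := congrArg (WithLp.sndₗ 2 ℝ F F) h2
    rw [map_sum] at this
    exact this
  have h5 : ∀ l, ((b'.toBasis.toMatrix b).map Complex.ofRealHom *
        frameMatrix b (fun k => (u k : SympSpace F))) j l =
      ((inner ℝ (b' j) (u l : SympSpace F).fst : ℝ) : ℂ) +
        Complex.I * ((inner ℝ (b' j) (u l : SympSpace F).snd : ℝ) : ℂ) := by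
    intro l
    rw [Matrix.mul_apply, ← h1, ← h1]
    push_cast
    rw [Finset.mul_sum, ← Finset.sum_add_distrib]
    refine Finset.sum_congr rfl fun i _ => ?_
    simp only [Matrix.map_apply, Module.Basis.toMatrix_apply,
      OrthonormalBasis.coe_toBasis_repr_apply, OrthonormalBasis.repr_apply_apply,
      frameMatrix, Matrix.of_apply, Complex.ofRealHom_eq_coe]
    ring
  rw [Matrix.mul_apply]
  simp only [h5]
  simp only [Matrix.map_apply, Module.Basis.toMatrix_apply, OrthonormalBasis.coe_toBasis_repr_apply,
      OrthonormalBasis.repr_apply_apply, Complex.ofRealHom_eq_coe, frameMatrix, Matrix.of_apply]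
  rw [h3, h4, inner_sum, inner_sum]
  push_cast
  rw [Finset.mul_sum, ← Finset.sum_add_distrib]
  refine Finset.sum_congr rfl fun i _ => ?_
  rw [real_inner_smul_right, real_inner_smul_right]
  push_cast
  ring

/-- Changing the orthonormal bases of `F` and of `L` multiplies the frame matrix by real orthogonal
matrices, whose determinants are `±1`; squaring removes the sign. -/
theorem IsSqDet.unique {L : Submodule ℝ (SympSpace F)} {z z' : ℂ} (h : IsSqDet L z)
    (h' : IsSqDet L z') : z = z' := by
  obtain ⟨n, b, u, rfl⟩ := h
  obtain ⟨n', b', u', rfl⟩ := h'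
  obtain rfl : n = n' := by
    have h1 := Module.finrank_eq_card_basis b.toBasis
    have h2 := Module.finrank_eq_card_basis b'.toBasis
    rw [h1] at h2
    simpa using h2
  rw [frameMatrix_change b b' u u', Matrix.det_mul, Matrix.det_mul, mul_pow, mul_pow,
    sq_det_map_ofReal_toMatrix, sq_det_map_ofReal_toMatrix, one_mul, mul_one]

/-- The argument of `(τ + i (1 + κ τ))²`, chosen continuously in `τ`. -/
def phaseFun (κ τ : ℝ) : ℝ :=
  2 * Complex.arg (((1 + κ * τ : ℝ) : ℂ) - τ * Complex.I) + Real.pi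

/-- One has `τ + i (1 + κ τ) = i (1 + κ τ - i τ)`, and the factor `i` accounts for the summand `π`.
The other factor is real only for `τ = 0`, where it equals `1`, so it avoids the cut of the
principal argument. -/
theorem continuous_phaseFun (κ : ℝ) : Continuous (phaseFun κ) := by
  refine (continuous_const.mul ?_).add continuous_const
  rw [continuous_iff_continuousAt]
  intro τ
  refine ContinuousAt.comp (g := Complex.arg) (Complex.continuousAt_arg ?_)
    (Continuous.continuousAt (by fun_prop))
  rw [Complex.mem_slitPlane_iff]
  by_cases h : τ = 0
  · left; simp [h]
  · right; simpa using h

theorem exp_phaseFun (κ τ : ℝ) :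
    Complex.exp (Complex.I * (phaseFun κ τ : ℂ)) =
      ((τ + Complex.I * ((1 + κ * τ : ℝ) : ℂ)) /
        ((Real.sqrt (τ ^ 2 + (1 + κ * τ) ^ 2) : ℝ) : ℂ)) ^ 2 := by
  set c : ℂ := ((1 + κ * τ : ℝ) : ℂ) - τ * Complex.I with hc
  have hnorm : ‖c‖ = Real.sqrt (τ ^ 2 + (1 + κ * τ) ^ 2) := by
    rw [Complex.norm_eq_sqrt_sq_add_sq]
    congr 1
    simp [hc]
    ring
  have hpos : 0 < Real.sqrt (τ ^ 2 + (1 + κ * τ) ^ 2) := by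
    apply Real.sqrt_pos.2
    by_cases h : τ = 0
    · simp [h]
    · positivity
  have h1 : Complex.exp (c.arg * Complex.I) = c / (‖c‖ : ℂ) := by
    rw [eq_div_iff, mul_comm]
    · exact Complex.norm_mul_exp_arg_mul_I c
    · rw [hnorm]; exact_mod_cast hpos.ne'
  have h2 : Complex.I * (phaseFun κ τ : ℂ) =
      c.arg * Complex.I + c.arg * Complex.I + Real.pi * Complex.I := by
    simp only [phaseFun, ← hc]; push_cast; ring
  have h3 : (τ + Complex.I * ((1 + κ * τ : ℝ) : ℂ)) = Complex.I * c := by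
    rw [hc, mul_sub]
    linear_combination (τ : ℂ) * Complex.I_mul_I
  rw [h2, Complex.exp_add, Complex.exp_add, Complex.exp_pi_mul_I, h1, h3, hnorm, div_pow, mul_pow,
    Complex.I_sq]
  ring

variable [FiniteDimensional ℝ F]

/-- A continuous argument of the squared determinant of `chart κ T`. -/
def phase (κ : ℝ) (T : F →L[ℝ] F) : ℝ := eigSum (phaseFun κ) T

/-- An orthonormal eigenbasis `e j` of `T` diagonalizes the problem: the normalized vectors `(τ j e
j, (1 + κ τ j) e j)` form an orthonormal basis of the chart, and their frame matrix is diagonal. -/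
theorem isSqDet_chart {κ : ℝ} {T : F →L[ℝ] F} (hT : (T : F →ₗ[ℝ] F).IsSymmetric) :
    IsSqDet (chart κ T) (Complex.exp (Complex.I * (phase κ T : ℂ))) := by
  obtain ⟨e, τ, h⟩ := exists_eigenbasis hT
  set ρ : Fin (Module.finrank ℝ F) → ℝ :=
    fun j => Real.sqrt ((τ j) ^ 2 + (1 + κ * τ j) ^ 2) with hρ
  have hρ2 : ∀ j, 0 < (τ j) ^ 2 + (1 + κ * τ j) ^ 2 := by
    intro j
    by_cases h : τ j = 0
    · simp [h]
    · positivity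
  have hρpos : ∀ j, 0 < ρ j := fun j => Real.sqrt_pos.2 (hρ2 j)
  set u : Fin (Module.finrank ℝ F) → chart κ T :=
    fun j => ⟨chartMap κ T ((ρ j)⁻¹ • e j), ⟨_, rfl⟩⟩ with hu
  have hufst : ∀ j, (u j : SympSpace F).fst = ((ρ j)⁻¹ * τ j) • e j := by
    intro j
    change T ((ρ j)⁻¹ • e j) = _
    rw [map_smul, h, smul_smul]
  have husnd : ∀ j, (u j : SympSpace F).snd = ((ρ j)⁻¹ * (1 + κ * τ j)) • e j := by
    intro j
    change (ρ j)⁻¹ • e j + κ • T ((ρ j)⁻¹ • e j) = _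
    rw [map_smul, h, smul_smul, smul_smul, ← add_smul]
    congr 1; ring
  have heij : ∀ i j, inner ℝ (e i) (e j) = if i = j then (1 : ℝ) else 0 :=
    orthonormal_iff_ite.1 e.orthonormal
  have huo : Orthonormal ℝ u := by
    rw [orthonormal_iff_ite]
    intro i j
    have h0 : inner ℝ (u i) (u j) = inner ℝ (u i : SympSpace F).fst (u j : SympSpace F).fst +
        inner ℝ (u i : SympSpace F).snd (u j : SympSpace F).snd :=
      WithLp.prod_inner_apply _ _
    rw [h0, hufst, hufst, husnd, husnd]
    simp only [real_inner_smul_left, real_inner_smul_right, heij]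
    by_cases hij : i = j
    · subst hij
      simp only [if_true]
      have h1 : (ρ i) ^ 2 = (τ i) ^ 2 + (1 + κ * τ i) ^ 2 := Real.sq_sqrt (hρ2 i).le
      have h2 := (hρpos i).ne'
      field_simp
      linarith
    · simp [hij]
  have hspan : ⊤ ≤ Submodule.span ℝ (Set.range u) := by
    rw [top_le_iff]
    refine huo.linearIndependent.span_eq_top_of_card_eq_finrank' ?_
    rw [Fintype.card_fin]
    exact (LinearMap.finrank_range_of_inj (chartMap_injective κ T)).symm
  refine ⟨_, e, OrthonormalBasis.mk huo hspan, ?_⟩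
  have hdiag : frameMatrix e (fun k => ((OrthonormalBasis.mk huo hspan) k : SympSpace F)) =
      Matrix.diagonal fun j => ((τ j + Complex.I * ((1 + κ * τ j : ℝ) : ℂ)) / ((ρ j : ℝ) : ℂ)) := by
    ext i j
    simp only [frameMatrix, OrthonormalBasis.coe_mk, Matrix.of_apply, hufst, husnd,
      real_inner_smul_right, heij, Matrix.diagonal_apply]
    by_cases hij : i = j
    · subst hij
      simp only [if_true]
      push_cast
      ring
    · simp [hij]
  rw [hdiag, Matrix.det_diagonal, phase, eigSum_eq e.toBasis _ (τ := τ) (by simpa using h),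
    ← Finset.prod_pow]
  push_cast
  rw [Finset.mul_sum, Complex.exp_sum]
  refine Finset.prod_congr rfl fun j _ => ?_
  rw [exp_phaseFun]
  push_cast
  rfl

theorem continuousOn_phase {X : Type*} [TopologicalSpace X] (κ : ℝ) {T : X → (F →L[ℝ] F)}
    {s : Set X} (hT : ContinuousOn T s) (hs : ∀ t ∈ s, (T t : F →ₗ[ℝ] F).IsSymmetric) :
    ContinuousOn (fun t => phase κ (T t)) s :=
  continuousOn_eigSum (continuous_phaseFun κ) hT hs

/-- Two continuous arguments of the same function have the same variation. -/
theorem sub_eq_sub_of_exp_eq {θ₁ θ₂ : ℝ → ℝ} {p q : ℝ} (hpq : p ≤ q)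
    (h1 : ContinuousOn θ₁ (Icc p q)) (h2 : ContinuousOn θ₂ (Icc p q))
    (h : ∀ t ∈ Icc p q, Complex.exp (Complex.I * (θ₁ t : ℂ)) =
      Complex.exp (Complex.I * (θ₂ t : ℂ))) :
    θ₁ q - θ₁ p = θ₂ q - θ₂ p := by
  have hk : ∀ t ∈ Icc p q, ∃ k : ℤ, (k : ℝ) = (θ₁ t - θ₂ t) / (2 * Real.pi) := by
    intro t ht
    obtain ⟨k, hk⟩ := Complex.exp_eq_exp_iff_exists_int.1 (h t ht)
    refine ⟨k, ?_⟩
    have h3 : Complex.I * ((θ₁ t : ℂ) - θ₂ t - k * (2 * Real.pi)) = 0 := by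
      linear_combination hk
    have h4 : ((θ₁ t : ℂ) - θ₂ t - k * (2 * Real.pi)) = 0 :=
      (mul_eq_zero.1 h3).resolve_left Complex.I_ne_zero
    have h5 : θ₁ t - θ₂ t - k * (2 * Real.pi) = 0 := by exact_mod_cast h4
    rw [eq_div_iff (by positivity)]
    linarith
  have hc : ContinuousOn (fun t => (θ₁ t - θ₂ t) / (2 * Real.pi)) (Icc p q) :=
    (h1.sub h2).div_const _
  choose! k hk using hk
  have hkc : ContinuousOn k (Icc p q) := by
    rw [Int.isClosedEmbedding_coe_real.isInducing.continuousOn_iff]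
    exact hc.congr hk
  have hkq := hk q (right_mem_Icc.2 hpq)
  rw [isPreconnected_Icc.constant hkc (right_mem_Icc.2 hpq) (left_mem_Icc.2 hpq),
    hk p (left_mem_Icc.2 hpq), div_left_inj' (by positivity)] at hkq
  linarith

/-- The quadratic form `w ↦ ⟨T w, w⟩`. -/
def opForm (T : F →L[ℝ] F) : QuadraticForm ℝ F :=
  LinearMap.BilinMap.toQuadraticMap ((innerₗ F) ∘ₗ (T : F →ₗ[ℝ] F))

theorem opForm_apply (T : F →L[ℝ] F) (w : F) : opForm T w = inner ℝ (T w) w := rfl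

/-- The quadratic form `w ↦ ⟨w + κ T w, w⟩`. -/
def chartForm (κ : ℝ) (T : F →L[ℝ] F) : QuadraticForm ℝ F :=
  opForm (ContinuousLinearMap.id ℝ F + κ • T)

theorem chartForm_apply (κ : ℝ) (T : F →L[ℝ] F) (w : F) :
    chartForm κ T w = inner ℝ (w + κ • T w) w := rfl

/-- The complex numbers behind the two phases differ by the real factor `1 + κ τ`. A positive factor
preserves the argument, and a negative one shifts it by `π`, which is then doubled. The direction of
the shift is known because `κ > 0` and `1 + κ τ < 0` force `τ < 0`. -/
theorem phaseFun_zero_eq {κ τ : ℝ} (hκ : 0 < κ) (h : 1 + κ * τ ≠ 0) :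
    phaseFun 0 (τ / (1 + κ * τ)) =
      phaseFun κ τ - if 1 + κ * τ < 0 then 2 * Real.pi else 0 := by
  set d := 1 + κ * τ with hd
  have hmul : (((1 + 0 * (τ / d) : ℝ) : ℂ) - ((τ / d : ℝ) : ℂ) * Complex.I) * (d : ℂ) =
      (d : ℂ) - τ * Complex.I := by
    have : (d : ℂ) ≠ 0 := by exact_mod_cast h
    push_cast
    field_simp
    ring
  simp only [phaseFun, ← hd]
  rw [← hmul]
  set x : ℂ := ((1 + 0 * (τ / d) : ℝ) : ℂ) - ((τ / d : ℝ) : ℂ) * Complex.I with hx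
  rcases lt_or_gt_of_ne h with hneg | hpos
  · have hτ : τ < 0 := by
      by_contra hτ
      rw [not_lt] at hτ
      have := mul_nonneg hκ.le hτ
      linarith
    have him : x.im < 0 := by
      have h1 : x.im = -(τ / d) := by simp [hx]
      rw [h1, neg_lt_zero]
      exact div_pos_of_neg_of_neg hτ hneg
    have h2 : x * (d : ℂ) = -x * ((-d : ℝ) : ℂ) := by push_cast; ring
    rw [h2, Complex.arg_mul_real (neg_pos.2 hneg), Complex.arg_neg_eq_arg_add_pi_of_im_neg him,
      if_pos hneg]
    ring
  · rw [Complex.arg_mul_real hpos, if_neg hpos.not_gt]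
    ring

theorem sigNeg_chartForm {κ : ℝ} {T : F →L[ℝ] F}
    (e : OrthonormalBasis (Fin (Module.finrank ℝ F)) ℝ F) {τ : Fin (Module.finrank ℝ F) → ℝ}
    (h : ∀ j, T (e j) = τ j • e j) :
    sigNeg (chartForm κ T) = {j | 1 + κ * τ j < 0}.ncard := by
  classical
  have heij : ∀ i j, inner ℝ (e i) (e j) = if i = j then (1 : ℝ) else 0 :=
    orthonormal_iff_ite.1 e.orthonormal
  have hQ : ∀ j, chartForm κ T (e j) = 1 + κ * τ j := by
    intro j
    simp [chartForm_apply, h, inner_add_left, real_inner_smul_left]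
  have horth : (QuadraticMap.associated (R := ℝ) (chartForm κ T)).IsOrthoᵢ e.toBasis := by
    intro i j hij
    have h1 : QuadraticMap.polar (chartForm κ T) (e i) (e j) = 0 := by
      simp only [QuadraticMap.polar, chartForm_apply, map_add, h, inner_add_left, inner_add_right,
        smul_add, real_inner_smul_left, heij, if_neg hij, if_neg (Ne.symm hij)]
      simp
    rw [QuadraticMap.polar] at h1
    change QuadraticMap.associated (R := ℝ) (chartForm κ T) (e.toBasis i) (e.toBasis j) = 0
    rw [OrthonormalBasis.coe_toBasis, QuadraticMap.associated_apply, h1, smul_zero]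
  rw [QuadraticForm.sigNeg_of_equiv_weightedSumSquares
    ⟨QuadraticForm.isometryEquivWeightedSumSquares (chartForm κ T) e.toBasis horth⟩]
  simp [hQ]

/-- Equality of the subspaces means `S (w + κ T w) = T w`. Hence `S` has the eigenvectors of `T`,
with eigenvalues `τ / (1 + κ τ)`, and each negative `1 + κ τ` costs one turn. -/
theorem phase_zero_eq {κ : ℝ} (hκ : 0 < κ) {S T : F →L[ℝ] F}
    (hT : (T : F →ₗ[ℝ] F).IsSymmetric) (h : chart κ T = chart 0 S) :
    phase 0 S = phase κ T - 2 * Real.pi * sigNeg (chartForm κ T) := by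
  obtain ⟨e, τ, he⟩ := exists_eigenbasis hT
  have hST : ∀ w, S (w + κ • T w) = T w := by
    intro w
    have h1 : chartMap κ T w ∈ chart 0 S := h ▸ ⟨w, rfl⟩
    simpa using mem_chart'.1 h1
  have h1 : ∀ j, (1 + κ * τ j) • S (e j) = τ j • e j := by
    intro j
    rw [← he, ← hST (e j), he, smul_smul, ← map_smul, add_smul, one_smul]
  have hne : ∀ j, 1 + κ * τ j ≠ 0 := by
    intro j hj
    have h2 := h1 j
    rw [hj, zero_smul] at h2
    have h3 : τ j = 0 := (smul_eq_zero.1 h2.symm).resolve_right (e.orthonormal.ne_zero j)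
    rw [h3, mul_zero, add_zero] at hj
    exact one_ne_zero hj
  have hS : ∀ j, S (e j) = (τ j / (1 + κ * τ j)) • e j := by
    intro j
    rw [div_eq_inv_mul, mul_smul, ← h1 j, smul_smul, inv_mul_cancel₀ (hne j), one_smul]
  rw [phase, phase, eigSum_eq e.toBasis _ (T := T) (τ := τ) (by simpa using he),
    eigSum_eq e.toBasis _ (T := S) (by simpa using hS), sigNeg_chartForm e he,
    Finset.sum_congr rfl fun j _ => phaseFun_zero_eq hκ (hne j), Finset.sum_sub_distrib,
    Finset.sum_ite, Finset.sum_const_zero, add_zero, Finset.sum_const, nsmul_eq_mul,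
    Set.ncard_eq_toFinset_card', Set.toFinset_ofPred]
  ring

end SqDet

/-! ### Jump of the negative index at a nondegenerate zero -/

section Signature

variable {F : Type*} [NormedAddCommGroup F] [InnerProductSpace ℝ F] [FiniteDimensional ℝ F]

theorem exists_coercive (T : F →L[ℝ] F) (W : Submodule ℝ F)
    (h : ∀ w ∈ W, w ≠ 0 → 0 < inner ℝ (T w) w) :
    ∃ α : ℝ, 0 < α ∧ ∀ w ∈ W, α * ‖w‖ ^ 2 ≤ inner ℝ (T w) w := by
  have hcomp : IsCompact (Metric.sphere (0 : F) 1 ∩ W) :=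
    (isCompact_sphere 0 1).inter_right W.closed_of_finiteDimensional
  have hcont : ContinuousOn (fun w : F => inner ℝ (T w) w) (Metric.sphere (0 : F) 1 ∩ W) :=
    Continuous.continuousOn (by fun_prop)
  obtain ⟨α, hα, hle⟩ : ∃ α : ℝ, 0 < α ∧ ∀ w ∈ Metric.sphere (0 : F) 1 ∩ W,
      α ≤ inner ℝ (T w) w := by
    rcases (Metric.sphere (0 : F) 1 ∩ W).eq_empty_or_nonempty with he | hne
    · exact ⟨1, one_pos, fun w hw => by rw [he] at hw; exact hw.elim⟩
    · obtain ⟨w₀, hw₀, hmin⟩ := hcomp.exists_isMinOn hne hcont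
      refine ⟨_, h w₀ hw₀.2 ?_, fun w hw => hmin hw⟩
      rintro rfl
      simpa using hw₀.1
  refine ⟨α, hα, fun w hw => ?_⟩
  by_cases hw0 : w = 0
  · simp [hw0]
  have hn : 0 < ‖w‖ := norm_pos_iff.2 hw0
  have h1 := hle (‖w‖⁻¹ • w) ⟨by simp [norm_smul, hn.ne'], W.smul_mem _ hw⟩
  rw [map_smul, real_inner_smul_left, real_inner_smul_right, ← mul_assoc, ← mul_inv,
    inv_mul_eq_div, le_div_iff₀ (by positivity)] at h1
  rwa [pow_two]

/-- On `V` the form is positive at order zero, and on `K` at order one in `t - s`. The mixed terms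
have order `(t - s) ‖v‖ ‖k‖`; Young's inequality splits them into a small part of the `K` term and a
multiple of `(t - s) ‖v‖²`, which the order zero term dominates. -/
theorem eventually_pos_of_hasDerivAt {G : ℝ → (F →L[ℝ] F)} {G' : F →L[ℝ] F} {s : ℝ}
    (hG : HasDerivAt G G' s) (hs : (G s : F →ₗ[ℝ] F).IsSymmetric) (V K : Submodule ℝ F)
    (hV : ∀ v ∈ V, v ≠ 0 → 0 < inner ℝ (G s v) v) (hK : ∀ k ∈ K, G s k = 0)
    (hK' : ∀ k ∈ K, k ≠ 0 → 0 < inner ℝ (G' k) k) :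
    ∀ᶠ t in 𝓝[>] s, ∀ w ∈ V ⊔ K, w ≠ 0 → 0 < inner ℝ (G t w) w := by
  obtain ⟨α, hα, hVα⟩ := exists_coercive (G s) V hV
  obtain ⟨β, hβ, hKβ⟩ := exists_coercive G' K hK'
  have hslope : Tendsto (slope G s) (𝓝[>] s) (𝓝 G') :=
    (hasDerivAt_iff_tendsto_slope.1 hG).mono_left
      (nhdsWithin_mono _ fun t (ht : s < t) => ht.ne')
  have hD : ∀ᶠ t in 𝓝[>] s, ‖slope G s t - G'‖ < β / 8 := by
    have := (tendsto_iff_norm_sub_tendsto_zero.1 hslope).eventually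
      (gt_mem_nhds (show (0 : ℝ) < β / 8 by positivity))
    exact this
  set C := ‖G'‖
  -- The three terms bound the `‖v‖²` coefficients coming from `⟨G' v, v⟩`, from the error `D - G'`
  -- and from Young's inequality; the final `1` leaves a strictly positive margin.
  set M := C + β / 4 + 4 * C ^ 2 / β + 1 with hM
  have hC : 0 ≤ C := norm_nonneg _
  have hMpos : 0 < M := by positivity
  have hlt : ∀ᶠ t in 𝓝[>] s, t < s + α / M := by
    have : s < s + α / M := by linarith [div_pos hα hMpos]
    exact (gt_mem_nhds this).filter_mono nhdsWithin_le_nhds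
  filter_upwards [hD, hlt, self_mem_nhdsWithin] with t hD hlt hst w hw hw0
  obtain ⟨v, hv, k, hk, rfl⟩ := Submodule.mem_sup.1 hw
  have hst' : 0 < t - s := sub_pos.2 hst
  set D := slope G s t with hDdef
  have hGt : G t = G s + (t - s) • D := by
    rw [hDdef, slope_def_module, smul_smul, mul_inv_cancel₀ hst'.ne', one_smul]
    abel
  have h0 : inner ℝ (G s (v + k)) (v + k) = inner ℝ (G s v) v := by
    rw [map_add, hK k hk, add_zero, inner_add_right]
    have : inner ℝ (G s v) k = inner ℝ v (G s k) := hs v k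
    rw [this, hK k hk, inner_zero_right, add_zero]
  have h1 : inner ℝ (D (v + k)) (v + k) =
      inner ℝ (G' (v + k)) (v + k) + inner ℝ ((D - G') (v + k)) (v + k) := by
    rw [sub_apply, inner_sub_left]; ring
  have h2 : -(β / 8 * ‖v + k‖ ^ 2) ≤ inner ℝ ((D - G') (v + k)) (v + k) := by
    have h3 := abs_real_inner_le_norm ((D - G') (v + k)) (v + k)
    have h4 := (D - G').le_opNorm (v + k)
    have h5 : ‖(D - G') (v + k)‖ * ‖v + k‖ ≤ β / 8 * ‖v + k‖ ^ 2 := by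
      rw [pow_two, ← mul_assoc]
      refine mul_le_mul_of_nonneg_right (h4.trans ?_) (norm_nonneg _)
      exact mul_le_mul_of_nonneg_right hD.le (norm_nonneg _)
    have h6 := (abs_le.1 (h3.trans h5)).1
    exact h6
  have h3 : ‖v + k‖ ^ 2 ≤ 2 * ‖v‖ ^ 2 + 2 * ‖k‖ ^ 2 := by
    have := norm_add_le v k
    nlinarith [norm_nonneg (v + k), norm_nonneg v, norm_nonneg k, sq_nonneg (‖v‖ - ‖k‖)]
  have hb : ∀ x y : F, -(C * ‖x‖ * ‖y‖) ≤ inner ℝ (G' x) y := by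
    intro x y
    have h4 := abs_real_inner_le_norm (G' x) y
    have h5 := mul_le_mul_of_nonneg_right (G'.le_opNorm x) (norm_nonneg y)
    exact (abs_le.1 (h4.trans h5)).1
  have h4 : β * ‖k‖ ^ 2 - 2 * C * ‖v‖ * ‖k‖ - C * ‖v‖ ^ 2 ≤ inner ℝ (G' (v + k)) (v + k) := by
    rw [map_add, inner_add_left, inner_add_right, inner_add_right]
    have := hb v v
    have := hb v k
    have := hb k v
    have := hKβ k hk
    nlinarith
  have h5 : 2 * C * ‖v‖ * ‖k‖ ≤ β / 4 * ‖k‖ ^ 2 + 4 * C ^ 2 / β * ‖v‖ ^ 2 := by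
    have h6 : 0 ≤ β / 4 * (‖k‖ - 4 * C / β * ‖v‖) ^ 2 := by positivity
    have h7 : β / 4 * (‖k‖ - 4 * C / β * ‖v‖) ^ 2 =
        β / 4 * ‖k‖ ^ 2 + 4 * C ^ 2 / β * ‖v‖ ^ 2 - 2 * C * ‖v‖ * ‖k‖ := by
      field_simp
      ring
    linarith
  have h6 : β / 2 * ‖k‖ ^ 2 - (M - 1) * ‖v‖ ^ 2 ≤ inner ℝ (D (v + k)) (v + k) := by
    rw [h1, hM]
    nlinarith
  have h7 : (t - s) * M < α := by
    rw [← lt_div_iff₀ hMpos]; linarith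
  have h8 := hVα v hv
  have h9 : inner ℝ (G t (v + k)) (v + k) =
      inner ℝ (G s v) v + (t - s) * inner ℝ (D (v + k)) (v + k) := by
    rw [hGt, add_apply, smul_apply, inner_add_left,
      real_inner_smul_left, h0]
  rw [h9]
  have h10 := mul_le_mul_of_nonneg_left h6 hst'.le
  have h11 : 0 ≤ (α - (t - s) * M) * ‖v‖ ^ 2 := mul_nonneg (by linarith) (by positivity)
  have h12 : 0 < (t - s) * (β / 2 * ‖k‖ ^ 2 + ‖v‖ ^ 2) := by
    apply mul_pos hst'
    by_cases hv0 : v = 0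
    · have hk0 : k ≠ 0 := by rintro rfl; simp [hv0] at hw0
      have := norm_pos_iff.2 hk0
      positivity
    · have := norm_pos_iff.2 hv0
      positivity
  nlinarith

theorem radical_opForm {T : F →L[ℝ] F} (hT : (T : F →ₗ[ℝ] F).IsSymmetric) :
    (opForm T).radical = LinearMap.ker (T : F →ₗ[ℝ] F) := by
  ext x
  rw [QuadraticMap.mem_radical_iff', LinearMap.mem_ker]
  have hs : ∀ v w, inner ℝ (T v) w = inner ℝ v (T w) := hT
  constructor
  · rintro ⟨h1, h2⟩
    have h3 := h2 (T x)
    simp only [opForm_apply, map_add, inner_add_left, inner_add_right] at h1 h3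
    rw [h1, hs (T x) x] at h3
    exact inner_self_eq_zero.1 (by linarith : inner ℝ (T x) (T x) = 0)
  · intro h
    have h0 : T x = 0 := h
    refine ⟨by simp [opForm_apply, h0], fun n => ?_⟩
    simp only [opForm_apply, map_add, h0, zero_add, inner_add_right, hs n x, inner_zero_right]

theorem finrank_sup_of_pos (T : F →L[ℝ] F) (V K : Submodule ℝ F)
    (hV : ∀ v ∈ V, v ≠ 0 → inner ℝ (T v) v ≠ 0) (hK : ∀ k ∈ K, T k = 0) :
    Module.finrank ℝ (V ⊔ K : Submodule ℝ F) = Module.finrank ℝ V + Module.finrank ℝ K := by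
  have h : V ⊓ K = ⊥ := by
    rw [Submodule.eq_bot_iff]
    rintro x ⟨hxV, hxK⟩
    by_contra hx
    exact hV x hxV hx (by rw [hK x hxK, inner_zero_left])
  have := Submodule.finrank_sup_add_finrank_inf_eq V K
  rwa [h, finrank_bot, add_zero] at this

theorem posDef_restrict_iff {V : Type*} [AddCommGroup V] [Module ℝ V] {Q : QuadraticForm ℝ V}
    {W : Submodule ℝ V} : (Q.restrict W).PosDef ↔ ∀ w ∈ W, w ≠ 0 → 0 < Q w :=
  ⟨fun h w hw h0 => h ⟨w, hw⟩ (by simpa using h0), fun h w h0 => h w w.2 (by simpa using h0)⟩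

theorem opForm_neg (T : F →L[ℝ] F) : opForm (-T) = -opForm T := by
  ext w
  simp [opForm_apply]

/-- A maximal positive subspace of `G s` and `K` are independent, since `G s` vanishes on `K`, and
their sum becomes positive definite just after `s`. -/
theorem eventually_finrank_le_sigPos {G : ℝ → (F →L[ℝ] F)} {G' : F →L[ℝ] F} {s : ℝ}
    (hG : HasDerivAt G G' s) (hs : (G s : F →ₗ[ℝ] F).IsSymmetric) (K : Submodule ℝ F)
    (hK : ∀ k ∈ K, G s k = 0) (hK' : ∀ k ∈ K, k ≠ 0 → 0 < inner ℝ (G' k) k) :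
    ∀ᶠ t in 𝓝[>] s, sigPos (opForm (G s)) + Module.finrank ℝ K ≤ sigPos (opForm (G t)) := by
  obtain ⟨V, hVr, hV⟩ := exists_finrank_eq_sigPos_and_posDef (opForm (G s))
  rw [posDef_restrict_iff] at hV
  filter_upwards [eventually_pos_of_hasDerivAt hG hs V K hV hK hK'] with t ht
  rw [← hVr, ← finrank_sup_of_pos (G s) V K (fun v hv h0 => (hV v hv h0).ne') hK]
  exact le_sigPos_of_posDef _ (posDef_restrict_iff.2 ht)

/-- The negative index of a differentiable path of symmetric operators, to the right of a time at
which the derivative is nondegenerate on the kernel. -/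
theorem eventually_sigNeg_right {G : ℝ → (F →L[ℝ] F)} {G' : F →L[ℝ] F} {s : ℝ}
    (hG : HasDerivAt G G' s) (hs : ∀ᶠ t in 𝓝 s, (G t : F →ₗ[ℝ] F).IsSymmetric)
    {K₁ K₂ : Submodule ℝ F} (h1 : ∀ k ∈ K₁, G s k = 0) (h2 : ∀ k ∈ K₂, G s k = 0)
    (h1' : ∀ k ∈ K₁, k ≠ 0 → 0 < inner ℝ (G' k) k) (h2' : ∀ k ∈ K₂, k ≠ 0 → inner ℝ (G' k) k < 0)
    (hr : Module.finrank ℝ K₁ + Module.finrank ℝ K₂ =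
      Module.finrank ℝ (LinearMap.ker (G s : F →ₗ[ℝ] F))) :
    ∀ᶠ t in 𝓝[>] s, sigNeg (opForm (G t)) = sigNeg (opForm (G s)) + Module.finrank ℝ K₂ ∧
      Function.Injective (G t) := by
  have hss := hs.self_of_nhds
  have hpos := eventually_finrank_le_sigPos hG hss K₁ h1 h1'
  have hneg := eventually_finrank_le_sigPos hG.neg (s := s) (K := K₂)
    (by intro v w; simpa using hss v w) (by simpa using h2) (by simpa using h2')
  filter_upwards [hpos, hneg, hs.filter_mono nhdsWithin_le_nhds] with t hpos hneg hst
  simp only [Pi.neg_apply, opForm_neg, sigPos_neg] at hneg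
  have e1 := QuadraticForm.sigPos_add_sigNeg_add_radical (Q := opForm (G s))
  have e2 := QuadraticForm.sigPos_add_sigNeg_add_radical (Q := opForm (G t))
  rw [radical_opForm hss] at e1
  rw [radical_opForm hst] at e2
  -- The lower bounds for the positive and negative indices of `G t` already add up to the dimension
  -- of `F`. Both are therefore equalities and nothing is left for the kernel.
  have e3 : Module.finrank ℝ (LinearMap.ker (G t : F →ₗ[ℝ] F)) = 0 := by omega
  refine ⟨by omega, ?_⟩
  rw [Submodule.finrank_eq_zero] at e3
  exact LinearMap.ker_eq_bot.1 e3

/-- Time reversal changes the sign of the derivative and so exchanges `K₁` and `K₂`. -/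
theorem eventually_sigNeg_left {G : ℝ → (F →L[ℝ] F)} {G' : F →L[ℝ] F} {s : ℝ}
    (hG : HasDerivAt G G' s) (hs : ∀ᶠ t in 𝓝 s, (G t : F →ₗ[ℝ] F).IsSymmetric)
    {K₁ K₂ : Submodule ℝ F} (h1 : ∀ k ∈ K₁, G s k = 0) (h2 : ∀ k ∈ K₂, G s k = 0)
    (h1' : ∀ k ∈ K₁, k ≠ 0 → 0 < inner ℝ (G' k) k) (h2' : ∀ k ∈ K₂, k ≠ 0 → inner ℝ (G' k) k < 0)
    (hr : Module.finrank ℝ K₁ + Module.finrank ℝ K₂ =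
      Module.finrank ℝ (LinearMap.ker (G s : F →ₗ[ℝ] F))) :
    ∀ᶠ t in 𝓝[<] s, sigNeg (opForm (G t)) = sigNeg (opForm (G s)) + Module.finrank ℝ K₁ ∧
      Function.Injective (G t) := by
  have hrefl : Tendsto (fun t : ℝ => -t) (𝓝[<] s) (𝓝[>] (-s)) := tendsto_neg_nhdsLT
  have hG2 : HasDerivAt (fun t => G (-t)) (-G') (-s) := by
    have h := hG
    rw [← neg_neg s] at h
    have h2 := h.scomp (-s) (hasDerivAt_neg (-s))
    rw [neg_one_smul] at h2
    exact h2
  have hs2 : ∀ᶠ t in 𝓝 (-s), (G (-t) : F →ₗ[ℝ] F).IsSymmetric := by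
    have : Tendsto (fun t : ℝ => -t) (𝓝 (-s)) (𝓝 s) := by
      simpa using (continuous_neg (G := ℝ)).tendsto (-s)
    exact this.eventually hs
  have key := eventually_sigNeg_right (s := -s) hG2 hs2 (K₁ := K₂) (K₂ := K₁)
    (by simpa using h2) (by simpa using h1) (by simpa using h2') (by simpa using h1')
    (by rw [add_comm, hr, neg_neg])
  filter_upwards [hrefl.eventually key] with t ht
  simpa using ht

end Signature

/-! ### Graphs of self-adjoint Fredholm operators -/

section Graph

variable {H : Type*} [NormedAddCommGroup H] [InnerProductSpace ℝ H] {T₀ : H →ₗ.[ℝ] H}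

/-- The continuous inclusion of the domain, with its graph norm. -/
def inclL (T₀ : H →ₗ.[ℝ] H) : GraphDomain T₀ →L[ℝ] H :=
  (graphIncl T₀).mkContinuous 1 fun u => by
    rw [one_mul]
    exact WithLp.norm_fst_le _ (graphEmb T₀ u)

theorem inclL_injective (T₀ : H →ₗ.[ℝ] H) : Function.Injective (inclL T₀) :=
  fun _ _ h => Subtype.ext h

theorem mem_graphS {B : GraphDomain T₀ →L[ℝ] H} {z : SympSpace H} :
    z ∈ graphS (toUnbounded B) ↔ ∃ u : GraphDomain T₀, inclL T₀ u = z.fst ∧ B u = z.snd := by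
  have : z ∈ graphS (toUnbounded B) ↔ WithLp.ofLp z ∈ (toUnbounded B).graph := Iff.rfl
  rw [this, LinearPMap.mem_graph_iff]
  rfl

theorem isClosed_sympOrth (W : Submodule ℝ (SympSpace H)) :
    IsClosed (sympOrth W : Set (SympSpace H)) := by
  have : (sympOrth W : Set (SympSpace H)) = ⋂ u ∈ W, {v | omega u v = 0} := by
    ext v
    simp [sympOrth]
  rw [this]
  refine isClosed_biInter fun u _ => isClosed_eq ?_ continuous_const
  have h1 : Continuous fun z : SympSpace H => z.fst := (WithLp.fstL 2 ℝ H H).continuous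
  have h2 : Continuous fun z : SympSpace H => z.snd := (WithLp.sndL 2 ℝ H H).continuous
  unfold omega
  fun_prop

variable [CompleteSpace H]

theorem inner_map_left {B : GraphDomain T₀ →L[ℝ] H} (hB : IsSelfAdjoint (toUnbounded B))
    (u v : GraphDomain T₀) : inner ℝ (B u) (inclL T₀ v) = inner ℝ (inclL T₀ u) (B v) := by
  have h := LinearPMap.adjoint_isFormalAdjoint hB.dense_domain
  rw [LinearPMap.isSelfAdjoint_def.1 hB] at h
  exact h u v

/-- This is the maximality in self-adjointness: the hypothesis puts `(y, z)` in the graph of the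
adjoint, which is the graph of `B`. -/
theorem exists_of_forall_inner {B : GraphDomain T₀ →L[ℝ] H} (hB : IsSelfAdjoint (toUnbounded B))
    {y z : H} (h : ∀ u, inner ℝ (B u) y = inner ℝ (inclL T₀ u) z) :
    ∃ v, inclL T₀ v = y ∧ B v = z := by
  have h' : ∀ u : (toUnbounded B).domain, inner ℝ z (u : H) = inner ℝ y (toUnbounded B u) := by
    intro u
    rw [real_inner_comm, ← real_inner_comm y]
    exact (h u).symm
  have h1 := LinearPMap.mem_adjoint_domain_of_exists (T := toUnbounded B) y ⟨z, h'⟩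
  have h2 := LinearPMap.adjoint_apply_eq hB.dense_domain ⟨y, h1⟩ h'
  have h3 : (y, z) ∈ (toUnbounded B).adjoint.graph :=
    (LinearPMap.mem_graph_iff _).2 ⟨⟨y, h1⟩, rfl, h2⟩
  rw [LinearPMap.isSelfAdjoint_def.1 hB] at h3
  exact mem_graphS.1 (show (WithLp.toLp 2 (y, z) : SympSpace H) ∈ graphS (toUnbounded B) from h3)

theorem isLagrangian_graphS {B : GraphDomain T₀ →L[ℝ] H} (hB : IsSelfAdjoint (toUnbounded B)) :
    IsLagrangian (graphS (toUnbounded B)) := by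
  have h : sympOrth (graphS (toUnbounded B)) = graphS (toUnbounded B) := by
    ext z
    rw [mem_graphS]
    constructor
    · intro hz
      refine exists_of_forall_inner hB fun u => ?_
      have := hz (WithLp.toLp 2 (inclL T₀ u, B u)) (mem_graphS.2 ⟨u, rfl, rfl⟩)
      simp only [omega] at this
      rw [real_inner_comm z.snd]
      exact (sub_eq_zero.1 this).symm
    · rintro ⟨v, h1, h2⟩ w hw
      obtain ⟨u, h3, h4⟩ := mem_graphS.1 hw
      rw [omega, ← h1, ← h2, ← h3, ← h4, inner_map_left hB, inner_map_left hB, real_inner_comm,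
        inner_map_left hB, sub_self]
  exact ⟨h ▸ isClosed_sympOrth _, h⟩

/-- The graph norm makes the domain isometric to the graph of `T₀`, which is closed because it is
Lagrangian. -/
theorem completeSpace_graphDomain {B : GraphDomain T₀ →L[ℝ] H} (h : toUnbounded B = T₀)
    (hB : IsSelfAdjoint (toUnbounded B)) : CompleteSpace (GraphDomain T₀) := by
  have hcl : IsClosed (graphS T₀ : Set (SympSpace H)) := by
    have := (isLagrangian_graphS hB).1
    rwa [h] at this
  have hiso : Isometry (graphEmb T₀) := AddMonoidHomClass.isometry_of_norm _ fun _ => rfl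
  have hr : Set.range (graphEmb T₀) = (graphS T₀ : Set (SympSpace H)) := by
    ext z
    have : z ∈ graphS T₀ ↔ WithLp.ofLp z ∈ T₀.graph := Iff.rfl
    rw [SetLike.mem_coe, this, LinearPMap.mem_graph_iff]
    constructor
    · rintro ⟨u, rfl⟩
      exact ⟨u, rfl, rfl⟩
    · rintro ⟨u, h1, h2⟩
      exact ⟨u, sympSpace_ext h1 h2⟩
  rw [completeSpace_iff_isComplete_range hiso.isUniformInducing, hr]
  exact hcl.isComplete

/-- The embedding `u ↦ (u, B u)` of the domain in `H × H`. -/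
def graphMap (B : GraphDomain T₀ →L[ℝ] H) : GraphDomain T₀ →L[ℝ] SympSpace H :=
  ((WithLp.prodContinuousLinearEquiv 2 ℝ H H).symm : H × H →L[ℝ] SympSpace H) ∘L
    ((inclL T₀).prod B)

theorem range_graphMap (B : GraphDomain T₀ →L[ℝ] H) :
    LinearMap.range (graphMap B : GraphDomain T₀ →ₗ[ℝ] SympSpace H) = graphS (toUnbounded B) := by
  ext z
  rw [mem_graphS]
  constructor
  · rintro ⟨u, rfl⟩
    exact ⟨u, rfl, rfl⟩
  · rintro ⟨u, h1, h2⟩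
    exact ⟨u, sympSpace_ext h1 h2⟩

theorem gapContinuousOn_graphS [CompleteSpace (GraphDomain T₀)]
    {A : ℝ → (GraphDomain T₀ →L[ℝ] H)} {s : Set ℝ} (hA : ContinuousOn A s)
    (hsa : ∀ t ∈ s, IsSelfAdjoint (toUnbounded (A t))) :
    GapContinuousOn (fun t => graphS (toUnbounded (A t))) s := by
  have h := continuousOn_starProjection_range (S := fun t => graphMap (A t)) (s := s) ?_ ?_
  · simp only [range_graphMap] at h
    exact h
  -- The embedding `u ↦ (u, A u)` is affine in `A`, so it inherits norm continuity.
  · have h1 : ∀ t, graphMap (A t) = graphMap 0 +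
        (((WithLp.prodContinuousLinearEquiv 2 ℝ H H).symm : H × H →L[ℝ] SympSpace H) ∘L
          ContinuousLinearMap.inr ℝ H H) ∘L A t :=
      fun t => ContinuousLinearMap.ext fun w =>
        sympSpace_ext (add_zero _).symm (zero_add _).symm
    simp_rw [h1]
    exact continuousOn_const.add (continuousOn_const.clm_comp hA)
  · intro t ht
    refine ContinuousLinearMap.antilipschitz_of_injective_of_isClosed_range _ ?_ ?_
    · intro u v huv
      exact inclL_injective T₀ (congrArg WithLp.fst huv)
    · have := (isLagrangian_graphS (hsa t ht)).1
      rw [← range_graphMap] at this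
      exact this

theorem mem_horizontal {I : Submodule ℝ H} {z : SympSpace H} :
    z ∈ horizontal I ↔ z.fst ∈ I ∧ z.snd = 0 := Iff.rfl

theorem mem_horizontal_sup_graphS {B : GraphDomain T₀ →L[ℝ] H} {z : SympSpace H} :
    z ∈ horizontal ⊤ ⊔ graphS (toUnbounded B) ↔
      z.snd ∈ LinearMap.range (B : GraphDomain T₀ →ₗ[ℝ] H) := by
  constructor
  · intro hz
    obtain ⟨x, hx, y, hy, rfl⟩ := Submodule.mem_sup.1 hz
    obtain ⟨u, -, hu⟩ := mem_graphS.1 hy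
    refine ⟨u, ?_⟩
    rw [WithLp.add_snd, (mem_horizontal.1 hx).2, zero_add]
    exact hu
  · rintro ⟨u, hu⟩
    rw [Submodule.mem_sup]
    refine ⟨z - graphMap B u, mem_horizontal.2 ⟨trivial, ?_⟩, graphMap B u,
      range_graphMap B ▸ ⟨u, rfl⟩, by abel⟩
    rw [WithLp.sub_snd, sub_eq_zero]
    exact hu.symm

/-- The sum is the preimage of the range of `B` under the second projection, and the intersection is
a copy of `ker B`; each Fredholm property of `B` transfers. -/
theorem isFredholmPair_graphS {B : GraphDomain T₀ →L[ℝ] H} (hB : IsFredholmOp (toUnbounded B)) :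
    IsFredholmPair (horizontal ⊤) (graphS (toUnbounded B)) := by
  obtain ⟨h1, h2, h3⟩ := hB
  refine ⟨?_, ?_, ?_⟩
  · have : ((horizontal ⊤ ⊔ graphS (toUnbounded B) : Submodule ℝ (SympSpace H)) :
        Set (SympSpace H)) =
        (WithLp.sndL 2 ℝ H H) ⁻¹' (LinearMap.range (toUnbounded B).toFun : Set H) := by
      ext z
      exact mem_horizontal_sup_graphS
    rw [this]
    exact h3.preimage (WithLp.sndL 2 ℝ H H).continuous
  · have : (horizontal ⊤ ⊓ graphS (toUnbounded B) : Submodule ℝ (SympSpace H)) =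
        (LinearMap.ker (B : GraphDomain T₀ →ₗ[ℝ] H)).map
          (graphMap B : GraphDomain T₀ →ₗ[ℝ] SympSpace H) := by
      ext z
      constructor
      · rintro ⟨hz1, hz2⟩
        obtain ⟨u, h4, h5⟩ := mem_graphS.1 hz2
        exact ⟨u, h5.trans (mem_horizontal.1 hz1).2, sympSpace_ext h4 h5⟩
      · rintro ⟨u, hu, rfl⟩
        exact ⟨mem_horizontal.2 ⟨trivial, hu⟩, mem_graphS.2 ⟨u, rfl, rfl⟩⟩
    have hfin : FiniteDimensional ℝ (LinearMap.ker (B : GraphDomain T₀ →ₗ[ℝ] H)) := h1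
    rw [this]
    exact Module.Finite.map _ _
  · let f : (SympSpace H ⧸ (horizontal ⊤ ⊔ graphS (toUnbounded B))) →ₗ[ℝ]
        (H ⧸ LinearMap.range (toUnbounded B).toFun) :=
      Submodule.mapQ _ _ (WithLp.sndₗ 2 ℝ H H) fun z hz => mem_horizontal_sup_graphS.1 hz
    refine FiniteDimensional.of_injective f ?_
    rw [injective_iff_map_eq_zero]
    intro x hx
    obtain ⟨z, rfl⟩ := Submodule.Quotient.mk_surjective _ x
    rw [Submodule.Quotient.mk_eq_zero]
    have : Submodule.Quotient.mk (p := LinearMap.range (toUnbounded B).toFun) z.snd = 0 := hx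
    exact mem_horizontal_sup_graphS.2 ((Submodule.Quotient.mk_eq_zero _).1 this)

theorem isCompl_graphS {B : GraphDomain T₀ →L[ℝ] H} (hB : Function.Bijective B) :
    IsCompl (graphS (toUnbounded B)) (horizontal ⊤) := by
  constructor
  · rw [Submodule.disjoint_def]
    intro z hz hz'
    obtain ⟨u, h1, h2⟩ := mem_graphS.1 hz
    have h3 := (mem_horizontal.1 hz').2
    rw [← h2] at h3
    have h4 : u = 0 := hB.1 (h3.trans (map_zero B).symm)
    refine sympSpace_ext ?_ ?_
    · rw [← h1, h4]; simp
    · rw [← h2, h4]; simp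
  · rw [codisjoint_iff, sup_comm, eq_top_iff]
    intro z _
    exact mem_horizontal_sup_graphS.2 (hB.2 z.snd)

end Graph

/-! ### Differentiating the inverse operator -/

section Inverse

variable {X Y Z W : Type*} [NormedAddCommGroup X] [NormedSpace ℝ X] [CompleteSpace X]
  [NormedAddCommGroup Y] [NormedSpace ℝ Y] [NormedAddCommGroup Z] [NormedSpace ℝ Z]
  [NormedAddCommGroup W] [NormedSpace ℝ W]

theorem eventually_isInvertible
    {M : ℝ → (X →L[ℝ] Y)} {s : ℝ} (hM : ContinuousAt M s) (h : (M s).IsInvertible) :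
    ∀ᶠ t in 𝓝 s, (M t).IsInvertible := by
  have : {N : X →L[ℝ] Y | N.IsInvertible} ∈ 𝓝 (M s) :=
    ContinuousLinearEquiv.isOpen.mem_nhds h
  exact hM this

theorem continuousOn_inverse
    {M : ℝ → (X →L[ℝ] Y)} {S : Set ℝ} (hM : ContinuousOn M S)
    (h : ∀ t ∈ S, (M t).IsInvertible) : ContinuousOn (fun t => (M t).inverse) S := by
  intro t ht
  have h1 : ContinuousAt ContinuousLinearMap.inverse (M t) :=
    ((h t ht).contDiffAt_map_inverse (n := 0)).continuousAt
  exact h1.comp_continuousWithinAt (hM t ht)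

/-- The resolvent identity expresses the slope of the inverse as `-M(t)⁻¹ ∘ slope M ∘ M(s)⁻¹`, and
inversion is continuous at `M s`. -/
theorem hasDerivAt_inverse
    {M : ℝ → (X →L[ℝ] Y)} {M' : X →L[ℝ] Y} {s : ℝ}
    (hM : HasDerivAt M M' s) (h : (M s).IsInvertible) :
    HasDerivAt (fun t => (M t).inverse) (-((M s).inverse ∘L M' ∘L (M s).inverse)) s := by
  have h1 : ContinuousAt ContinuousLinearMap.inverse (M s) :=
    (h.contDiffAt_map_inverse (n := 0)).continuousAt
  have h0 : Tendsto M (𝓝 s) (𝓝 (M s)) := hM.continuousAt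
  have h2 : Tendsto (fun t => (M t).inverse) (𝓝[≠] s) (𝓝 (M s).inverse) :=
    (h1.tendsto.comp h0).mono_left nhdsWithin_le_nhds
  have h3 := hasDerivAt_iff_tendsto_slope.1 hM
  rw [hasDerivAt_iff_tendsto_slope]
  have h4 : Tendsto (fun t => -((M t).inverse ∘L slope M s t ∘L (M s).inverse)) (𝓝[≠] s)
      (𝓝 (-((M s).inverse ∘L M' ∘L (M s).inverse))) := by
    have hc : Continuous fun p : (Y →L[ℝ] X) × (X →L[ℝ] Y) =>
        -(p.1 ∘L p.2 ∘L (M s).inverse) :=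
      (continuous_fst.clm_comp (continuous_snd.clm_comp continuous_const)).neg
    have h5 := h2.prodMk_nhds h3
    have h6 := hc.tendsto ((M s).inverse, M')
    exact Tendsto.comp (g := fun p : (Y →L[ℝ] X) × (X →L[ℝ] Y) =>
      -(p.1 ∘L p.2 ∘L (M s).inverse)) (f := fun t => ((M t).inverse, slope M s t)) h6 h5
  refine h4.congr' ?_
  filter_upwards [(eventually_isInvertible hM.continuousAt h).filter_mono nhdsWithin_le_nhds]
    with t ht
  ext w
  rw [slope_def_module, slope_def_module]
  simp only [neg_apply, ContinuousLinearMap.comp_apply, smul_apply, sub_apply, map_smul, map_sub,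
    h.self_apply_inverse, ht.inverse_apply_self]
  rw [← smul_neg, neg_sub]

theorem hasDerivAt_comp_inverse_sub_comp {A : ℝ → (X →L[ℝ] Y)} {A' : X →L[ℝ] Y} {s : ℝ}
    (hA : HasDerivAt A A' s) {C : X →L[ℝ] Y} (h : (A s - C).IsInvertible) (P : X →L[ℝ] Z)
    (J : W →L[ℝ] Y) :
    HasDerivAt (fun t => P ∘L (A t - C).inverse ∘L J)
      (P ∘L (-((A s - C).inverse ∘L A' ∘L (A s - C).inverse)) ∘L J) s := by
  have h1 := hasDerivAt_inverse (M := fun t => A t - C) (hA.sub_const C) h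
  have h2 := (hasDerivAt_const s P).clm_comp (h1.clm_comp (hasDerivAt_const s J))
  simpa using h2

end Inverse

/-! ### The finite rank perturbation and the reduced graph -/

section Perturbation

variable {H : Type*} [NormedAddCommGroup H] [InnerProductSpace ℝ H] [CompleteSpace H]
  {T₀ : H →ₗ.[ℝ] H}

/-- The finite rank perturbation `B - κ P_F` of `B`. -/
def pert (B : GraphDomain T₀ →L[ℝ] H) (F : Submodule ℝ H) [F.HasOrthogonalProjection] (κ : ℝ) :
    GraphDomain T₀ →L[ℝ] H :=
  B - κ • (F.starProjection ∘L inclL T₀)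

theorem pert_apply (B : GraphDomain T₀ →L[ℝ] H) (F : Submodule ℝ H) [F.HasOrthogonalProjection]
    (κ : ℝ) (u : GraphDomain T₀) :
    pert B F κ u = B u - κ • F.starProjection (inclL T₀ u) := rfl

theorem pert_zero (B : GraphDomain T₀ →L[ℝ] H) (F : Submodule ℝ H) [F.HasOrthogonalProjection] :
    pert B F 0 = B := by
  ext u
  simp [pert_apply]

theorem inner_pert_left {B : GraphDomain T₀ →L[ℝ] H} (hB : IsSelfAdjoint (toUnbounded B))
    (F : Submodule ℝ H) [F.HasOrthogonalProjection] (κ : ℝ) (u v : GraphDomain T₀) :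
    inner ℝ (pert B F κ u) (inclL T₀ v) = inner ℝ (inclL T₀ u) (pert B F κ v) := by
  rw [pert_apply, pert_apply, inner_sub_left, inner_sub_right, inner_map_left hB,
    real_inner_smul_left, real_inner_smul_right, Submodule.inner_starProjection_left_eq_right]

/-- The range of `B` lies in the range of the perturbation plus `F`, so the latter range has finite
codimension; with injectivity this makes it closed. By self-adjointness its orthogonal complement
consists of kernel vectors, hence is zero. -/
theorem isInvertible_pert [CompleteSpace (GraphDomain T₀)] {B : GraphDomain T₀ →L[ℝ] H}
    (hB : IsSelfAdjoint (toUnbounded B)) (hF : IsFredholmOp (toUnbounded B)) (F : Submodule ℝ H)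
    [FiniteDimensional ℝ F] [F.HasOrthogonalProjection] {κ : ℝ}
    (hinj : Function.Injective (pert B F κ)) : (pert B F κ).IsInvertible := by
  set M := pert B F κ with hM
  have hker : LinearMap.ker (M : GraphDomain T₀ →ₗ[ℝ] H) = ⊥ := LinearMap.ker_eq_bot.2 hinj
  obtain ⟨C, hC⟩ := Submodule.exists_isCompl (LinearMap.range (B : GraphDomain T₀ →ₗ[ℝ] H))
  have hCfin : FiniteDimensional ℝ C := by
    have : FiniteDimensional ℝ (H ⧸ LinearMap.range (B : GraphDomain T₀ →ₗ[ℝ] H)) := hF.2.1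
    exact LinearEquiv.finiteDimensional (Submodule.quotientEquivOfIsCompl _ C hC)
  have htop : LinearMap.range (M : GraphDomain T₀ →ₗ[ℝ] H) ⊔ (F ⊔ C) = ⊤ := by
    rw [eq_top_iff]
    intro z _
    have hz : z ∈ LinearMap.range (B : GraphDomain T₀ →ₗ[ℝ] H) ⊔ C := by
      rw [hC.sup_eq_top]; trivial
    obtain ⟨_, ⟨u, rfl⟩, c, hc, rfl⟩ := Submodule.mem_sup.1 hz
    have : (B : GraphDomain T₀ →ₗ[ℝ] H) u + c =
        M u + (κ • F.starProjection (inclL T₀ u) + c) := by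
      rw [hM, pert_apply]
      simp only [ContinuousLinearMap.coe_coe]
      abel
    rw [this]
    exact Submodule.add_mem_sup ⟨u, rfl⟩ (Submodule.add_mem_sup
      (F.smul_mem _ (Submodule.starProjection_apply_mem _ _)) hc)
  have hQfin : FiniteDimensional ℝ (H ⧸ LinearMap.range (M : GraphDomain T₀ →ₗ[ℝ] H)) := by
    refine Module.Finite.of_surjective
      ((Submodule.mkQ (LinearMap.range (M : GraphDomain T₀ →ₗ[ℝ] H))) ∘ₗ (F ⊔ C).subtype) ?_
    intro x
    obtain ⟨z, rfl⟩ := Submodule.Quotient.mk_surjective _ x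
    have hz : z ∈ LinearMap.range (M : GraphDomain T₀ →ₗ[ℝ] H) ⊔ (F ⊔ C) := by rw [htop]; trivial
    obtain ⟨y, hy, c, hc, rfl⟩ := Submodule.mem_sup.1 hz
    refine ⟨⟨c, hc⟩, ?_⟩
    change Submodule.Quotient.mk c = Submodule.Quotient.mk (y + c)
    rw [Submodule.Quotient.eq, sub_add_cancel_right]
    exact neg_mem hy
  obtain ⟨G, hG⟩ := Submodule.exists_isCompl (LinearMap.range (M : GraphDomain T₀ →ₗ[ℝ] H))
  have hGfin : FiniteDimensional ℝ G :=
    LinearEquiv.finiteDimensional (Submodule.quotientEquivOfIsCompl _ G hG)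
  have hcl : IsClosed (LinearMap.range (M : GraphDomain T₀ →ₗ[ℝ] H) : Set H) :=
    M.closed_complemented_range_of_isCompl_of_ker_eq_bot G hG G.closed_of_finiteDimensional hker
  have horth : (LinearMap.range (M : GraphDomain T₀ →ₗ[ℝ] H))ᗮ = ⊥ := by
    rw [Submodule.eq_bot_iff]
    intro y hy
    -- Orthogonality to the range is the weak form of `B y = κ P y`; self-adjointness puts `y` in
    -- the domain, so `y` is killed by the perturbation.
    have h1 : ∀ u, inner ℝ (B u) y = inner ℝ (inclL T₀ u) (κ • F.starProjection y) := by
      intro u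
      have h2 := (Submodule.mem_orthogonal _ y).1 hy (M u) ⟨u, rfl⟩
      rw [hM, pert_apply, inner_sub_left, sub_eq_zero, real_inner_smul_left,
        Submodule.inner_starProjection_left_eq_right] at h2
      rw [h2, real_inner_smul_right]
    obtain ⟨v, hv1, hv2⟩ := exists_of_forall_inner hB h1
    have h3 : M v = 0 := by rw [hM, pert_apply, hv1, hv2, sub_self]
    rw [← hv1, hinj (h3.trans (map_zero M).symm), map_zero]
  have hrange : LinearMap.range (M : GraphDomain T₀ →ₗ[ℝ] H) = ⊤ := by
    have := (Submodule.topologicalClosure_eq_top_iff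
      (K := LinearMap.range (M : GraphDomain T₀ →ₗ[ℝ] H))).2 horth
    rwa [hcl.submodule_topologicalClosure_eq] at this
  exact ⟨ContinuousLinearEquiv.ofBijective M hker hrange, by ext; rfl⟩

theorem isInvertible_of_injective [CompleteSpace (GraphDomain T₀)] {B : GraphDomain T₀ →L[ℝ] H}
    (hB : IsSelfAdjoint (toUnbounded B)) (hF : IsFredholmOp (toUnbounded B))
    (hinj : Function.Injective B) : B.IsInvertible := by
  rw [← pert_zero B ⊥] at hinj ⊢
  exact isInvertible_pert hB hF ⊥ hinj

/-- The compression `P_F (B - κ P_F)⁻¹` to `F` of the inverse of the perturbed operator. -/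
def compression (B : GraphDomain T₀ →L[ℝ] H) (F : Submodule ℝ H) [F.HasOrthogonalProjection]
    (κ : ℝ) : F →L[ℝ] F :=
  (F.orthogonalProjectionOnto ∘L inclL T₀) ∘L (pert B F κ).inverse ∘L F.subtypeL

theorem compression_apply (B : GraphDomain T₀ →L[ℝ] H) (F : Submodule ℝ H)
    [F.HasOrthogonalProjection] (κ : ℝ) (w : F) :
    compression B F κ w = F.orthogonalProjectionOnto (inclL T₀ ((pert B F κ).inverse w)) := rfl

theorem isSymmetric_compression {B : GraphDomain T₀ →L[ℝ] H}
    (hB : IsSelfAdjoint (toUnbounded B)) (F : Submodule ℝ H) [F.HasOrthogonalProjection] {κ : ℝ}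
    (h : (pert B F κ).IsInvertible) :
    (compression B F κ : F →ₗ[ℝ] F).IsSymmetric := by
  intro v w
  simp only [ContinuousLinearMap.coe_coe, compression_apply]
  rw [Submodule.inner_orthogonalProjectionOnto_eq_of_mem_right,
    Submodule.inner_orthogonalProjectionOnto_eq_of_mem_left]
  have := inner_pert_left hB F κ ((pert B F κ).inverse v) ((pert B F κ).inverse w)
  rw [h.self_apply_inverse, h.self_apply_inverse] at this
  exact this.symm

theorem map_inverse_pert {B : GraphDomain T₀ →L[ℝ] H} {F : Submodule ℝ H}
    [F.HasOrthogonalProjection] {κ : ℝ} (h : (pert B F κ).IsInvertible) (w : H) :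
    B ((pert B F κ).inverse w) =
      w + κ • F.starProjection (inclL T₀ ((pert B F κ).inverse w)) := by
  have := h.self_apply_inverse w
  rw [pert_apply, sub_eq_iff_eq_add] at this
  exact this

theorem continuousOn_compression [CompleteSpace (GraphDomain T₀)]
    {A : ℝ → (GraphDomain T₀ →L[ℝ] H)} {S : Set ℝ} (hA : ContinuousOn A S) (F : Submodule ℝ H)
    [F.HasOrthogonalProjection] {κ : ℝ} (h : ∀ t ∈ S, (pert (A t) F κ).IsInvertible) :
    ContinuousOn (fun t => compression (A t) F κ) S :=
  continuousOn_const.clm_comp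
    ((continuousOn_inverse (hA.sub continuousOn_const) h).clm_comp continuousOn_const)

theorem hasDerivAt_compression [CompleteSpace (GraphDomain T₀)]
    {A : ℝ → (GraphDomain T₀ →L[ℝ] H)} {A' : GraphDomain T₀ →L[ℝ] H} {s : ℝ}
    (hA : HasDerivAt A A' s) (F : Submodule ℝ H) [F.HasOrthogonalProjection] {κ : ℝ}
    (h : (pert (A s) F κ).IsInvertible) :
    HasDerivAt (fun t => compression (A t) F κ)
      ((F.orthogonalProjectionOnto ∘L inclL T₀) ∘L
        (-((pert (A s) F κ).inverse ∘L A' ∘L (pert (A s) F κ).inverse)) ∘L F.subtypeL) s :=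
  hasDerivAt_comp_inverse_sub_comp (X := GraphDomain T₀) hA h _ _

/-- Symmetry of the perturbation moves the outer inverse to the other side of the inner product; the
sign is that of the derivative of the inverse. -/
theorem inner_deriv_compression [CompleteSpace (GraphDomain T₀)]
    {B : GraphDomain T₀ →L[ℝ] H} (hB : IsSelfAdjoint (toUnbounded B)) (B' : GraphDomain T₀ →L[ℝ] H)
    (F : Submodule ℝ H) [F.HasOrthogonalProjection] {κ : ℝ} (h : (pert B F κ).IsInvertible)
    (w : F) :
    inner ℝ (((F.orthogonalProjectionOnto ∘L inclL T₀) ∘L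
        (-((pert B F κ).inverse ∘L B' ∘L (pert B F κ).inverse)) ∘L F.subtypeL) w) w =
      -inner ℝ (B' ((pert B F κ).inverse w)) (inclL T₀ ((pert B F κ).inverse w)) := by
  simp only [ContinuousLinearMap.comp_apply, neg_apply, map_neg, inner_neg_left,
    Submodule.subtypeL_apply]
  rw [Submodule.inner_orthogonalProjectionOnto_eq_of_mem_right]
  set x := (pert B F κ).inverse w
  have := inner_pert_left hB F κ ((pert B F κ).inverse (B' x)) x
  rw [h.self_apply_inverse, h.self_apply_inverse] at this
  rw [this]

theorem mem_sympOrth_horizontal {I : Submodule ℝ H} {z : SympSpace H} :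
    z ∈ sympOrth (horizontal I) ↔ z.snd ∈ Iᗮ := by
  rw [Submodule.mem_orthogonal']
  constructor
  · intro hz i hi
    have := hz (WithLp.toLp 2 (i, 0)) (mem_horizontal.2 ⟨hi, rfl⟩)
    simpa [omega] using this
  · intro hz w hw
    obtain ⟨h1, h2⟩ := mem_horizontal.1 hw
    rw [omega, hz _ h1, h2, inner_zero_left, sub_zero]

/-- The parameter of a point `(u, B u)` with `B u ∈ F` is `w = B u - κ P u`, which lies in `F`. Then
`u` is the inverse image of `w`, so `P u = T w` and `B u = w + κ T w`. -/
theorem reduction_graphS {B : GraphDomain T₀ →L[ℝ] H} {I : Submodule ℝ H} {κ : ℝ}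
    (h : (pert B Iᗮ κ).IsInvertible) :
    reduction I (graphS (toUnbounded B)) = chart κ (compression B Iᗮ κ) := by
  ext z
  rw [mem_chart]
  constructor
  · rintro ⟨y, ⟨hy1, hy2⟩, rfl⟩
    obtain ⟨u, h1, h2⟩ := mem_graphS.1 hy1
    have h3 : y.snd ∈ Iᗮ := mem_sympOrth_horizontal.1 hy2
    have h4 : pert B Iᗮ κ u ∈ Iᗮ := by
      rw [pert_apply, h2]
      exact sub_mem h3 (Submodule.smul_mem _ _ (Submodule.starProjection_apply_mem _ _))
    have h5 : compression B Iᗮ κ ⟨_, h4⟩ = Iᗮ.orthogonalProjectionOnto y.fst := by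
      rw [compression_apply, h.inverse_apply_self, h1]
    refine ⟨⟨_, h4⟩, h5, ?_⟩
    rw [h5]
    change _ = Iᗮ.orthogonalProjectionOnto y.snd
    refine Subtype.ext ?_
    have h6 : (Iᗮ.orthogonalProjectionOnto y.snd : H) = y.snd :=
      Submodule.starProjection_eq_self_iff.2 h3
    rw [h6]
    change pert B Iᗮ κ u + κ • Iᗮ.starProjection y.fst = y.snd
    rw [pert_apply, h1, h2, sub_add_cancel]
  · rintro ⟨w, h1, h2⟩
    set u := (pert B Iᗮ κ).inverse w with hu
    have h3 : B u = w + κ • Iᗮ.starProjection (inclL T₀ u) := map_inverse_pert h _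
    have h4 : B u ∈ Iᗮ := by
      rw [h3]
      exact add_mem w.2 (Submodule.smul_mem _ _ (Submodule.starProjection_apply_mem _ _))
    refine ⟨graphMap B u, ⟨mem_graphS.2 ⟨u, rfl, rfl⟩, mem_sympOrth_horizontal.2 h4⟩, ?_⟩
    refine sympSpace_ext h1 ?_
    rw [← h2]
    refine Subtype.ext ?_
    have h5 : (Iᗮ.orthogonalProjectionOnto (B u) : H) = B u :=
      Submodule.starProjection_eq_self_iff.2 h4
    exact h5.trans h3

theorem isClean_graphS {B : GraphDomain T₀ →L[ℝ] H} {I : Submodule ℝ H}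
    (hI : IsClosed (I : Set H)) {κ : ℝ} (h : (pert B Iᗮ κ).IsInvertible) :
    IsClean (graphS (toUnbounded B)) (horizontal I) := by
  have hIcomp : CompleteSpace I := hI.completeSpace_coe
  have hP : ∀ x, Iᗮ.starProjection x = 0 ↔ x ∈ I := by
    intro x
    rw [Submodule.starProjection_apply_eq_zero_iff, Submodule.orthogonal_orthogonal]
  constructor
  · rw [Submodule.eq_bot_iff]
    rintro z ⟨hz1, hz2⟩
    obtain ⟨u, h1, h2⟩ := mem_graphS.1 hz1
    obtain ⟨h3, h4⟩ := mem_horizontal.1 hz2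
    have h5 : pert B Iᗮ κ u = 0 := by
      rw [pert_apply, h1, h2, h4, (hP _).2 h3, smul_zero, sub_zero]
    have h6 : u = 0 := h.injective (h5.trans (map_zero _).symm)
    refine sympSpace_ext ?_ ?_
    · rw [← h1, h6]; simp
    · rw [h4]; simp
  -- If `(x, y) = (u, B u) + (i, 0)` with `i ∈ I`, then `B u - κ P u = y - κ P x`, so `u` must be `N
  -- (x, y)`. What remains is the closed condition `P u = P x`.
  · set N : SympSpace H → GraphDomain T₀ := fun z =>
      (pert B Iᗮ κ).inverse (z.snd - κ • Iᗮ.starProjection z.fst) with hN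
    have : ((graphS (toUnbounded B) ⊔ horizontal I : Submodule ℝ (SympSpace H)) :
        Set (SympSpace H)) =
        {z | Iᗮ.starProjection (inclL T₀ (N z)) = Iᗮ.starProjection z.fst} := by
      ext z
      rw [SetLike.mem_coe, Submodule.mem_sup]
      constructor
      · rintro ⟨x, hx, y, hy, rfl⟩
        obtain ⟨u, h1, h2⟩ := mem_graphS.1 hx
        obtain ⟨h3, h4⟩ := mem_horizontal.1 hy
        have h5 : N (x + y) = u := by
          rw [hN]
          simp only [WithLp.add_snd, WithLp.add_fst, h4, add_zero, map_add, (hP _).2 h3]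
          rw [← h1, ← h2, ← pert_apply, h.inverse_apply_self]
        change Iᗮ.starProjection (inclL T₀ (N (x + y))) = Iᗮ.starProjection (x + y).fst
        rw [h5, WithLp.add_fst, map_add, (hP _).2 h3, add_zero, h1]
      · intro hz
        have hz' : Iᗮ.starProjection (inclL T₀ (N z)) = Iᗮ.starProjection z.fst := hz
        refine ⟨graphMap B (N z), mem_graphS.2 ⟨_, rfl, rfl⟩, z - graphMap B (N z),
          mem_horizontal.2 ⟨?_, ?_⟩, by abel⟩
        · rw [← hP, WithLp.sub_fst, map_sub, sub_eq_zero]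
          exact hz'.symm
        · rw [WithLp.sub_snd, sub_eq_zero]
          have h5 : B (N z) = (z.snd - κ • Iᗮ.starProjection z.fst) +
              κ • Iᗮ.starProjection (inclL T₀ (N z)) := map_inverse_pert h _
          have h6 : (graphMap B (N z)).snd = B (N z) := rfl
          rw [h6, h5, hz', sub_add_cancel]
    rw [this]
    have h1 : Continuous fun z : SympSpace H => z.fst := (WithLp.fstL 2 ℝ H H).continuous
    have h2 : Continuous fun z : SympSpace H => z.snd := (WithLp.sndL 2 ℝ H H).continuous
    exact isClosed_eq (by fun_prop) (by fun_prop)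

/-- Otherwise each `κ = n + 1` has a nonzero `u n` with `B (u n) = κ P (u n)`. Cleanness makes `P (u
n)` nonzero, and the symmetry of `B` makes these vectors pairwise orthogonal, as for eigenvectors of
distinct eigenvalues. The finite-dimensional `F` cannot contain infinitely many of them. -/
theorem exists_pos_injective_pert {B : GraphDomain T₀ →L[ℝ] H}
    (hB : IsSelfAdjoint (toUnbounded B)) {I : Submodule ℝ H} (hI : IsClosed (I : Set H))
    [FiniteDimensional ℝ Iᗮ] (hcl : IsClean (graphS (toUnbounded B)) (horizontal I)) :
    ∃ κ : ℝ, 0 < κ ∧ Function.Injective (pert B Iᗮ κ) := by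
  have hIcomp : CompleteSpace I := hI.completeSpace_coe
  by_contra hcon
  push Not at hcon
  have hex : ∀ n : ℕ, ∃ u, u ≠ 0 ∧ pert B Iᗮ ((n : ℝ) + 1) u = 0 := by
    intro n
    have := hcon ((n : ℝ) + 1) (by positivity)
    rw [injective_iff_map_eq_zero] at this
    push Not at this
    obtain ⟨u, h1, h2⟩ := this
    exact ⟨u, h2, h1⟩
  choose u hu0 hu using hex
  have hBu : ∀ n, B (u n) = ((n : ℝ) + 1) • Iᗮ.starProjection (inclL T₀ (u n)) := fun n =>
    sub_eq_zero.1 (hu n)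
  set y : ℕ → Iᗮ := fun n => Iᗮ.orthogonalProjectionOnto (inclL T₀ (u n)) with hy
  have hyc : ∀ n, Iᗮ.starProjection (inclL T₀ (u n)) = y n := fun n => rfl
  have hy0 : ∀ n, y n ≠ 0 := by
    intro n hn
    have h1 : Iᗮ.starProjection (inclL T₀ (u n)) = 0 := by rw [hyc, hn]; rfl
    have h2 : inclL T₀ (u n) ∈ I := by
      rwa [Submodule.starProjection_apply_eq_zero_iff, Submodule.orthogonal_orthogonal] at h1
    have h3 : graphMap B (u n) ∈ graphS (toUnbounded B) ⊓ horizontal I :=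
      ⟨mem_graphS.2 ⟨u n, rfl, rfl⟩, mem_horizontal.2 ⟨h2, by
        change B (u n) = 0
        rw [hBu, h1, smul_zero]⟩⟩
    rw [hcl.1, Submodule.mem_bot] at h3
    have h4 : inclL T₀ (u n) = 0 := congrArg WithLp.fst h3
    exact hu0 n (inclL_injective T₀ (h4.trans (map_zero _).symm))
  have horth : Pairwise fun n m => inner ℝ (y n) (y m) = 0 := by
    intro n m hnm
    have h1 := inner_map_left hB (u n) (u m)
    rw [hBu, hBu, real_inner_smul_left, real_inner_smul_right, hyc, hyc] at h1
    have h2 : inner ℝ (y n : H) (inclL T₀ (u m)) = inner ℝ (y n) (y m) := by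
      rw [hy, Submodule.inner_orthogonalProjectionOnto_eq_of_mem_left]
    have h3 : inner ℝ (inclL T₀ (u n)) (y m : H) = inner ℝ (y n) (y m) := by
      rw [hy, Submodule.inner_orthogonalProjectionOnto_eq_of_mem_right]
    rw [h2, h3] at h1
    have h4 : ((n : ℝ) - m) * inner ℝ (y n) (y m) = 0 := by linear_combination h1
    exact (mul_eq_zero.1 h4).resolve_left (sub_ne_zero.2 (by exact_mod_cast hnm))
  have hli : LinearIndependent ℝ y := linearIndependent_of_ne_zero_of_inner_eq_zero hy0 horth
  exact not_finite_iff_infinite.2 inferInstance hli.finite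

end Perturbation

/-! ### The Maslov index computed in charts -/

section MaslovCharts

variable {F : Type*} [NormedAddCommGroup F] [InnerProductSpace ℝ F] [FiniteDimensional ℝ F]
  [CompleteSpace F]

theorem chart_zero_injective {S T : F →L[ℝ] F} (h : chart 0 S = chart 0 T) : S = T := by
  ext w
  have h1 : chartMap 0 S w ∈ chart 0 T := h ▸ ⟨w, rfl⟩
  have h2 := mem_chart'.1 h1
  simpa using h2.symm

theorem sub_eq_phase_sub {l : ℝ → Submodule ℝ (SympSpace F)} {θ : ℝ → ℝ} {p q κ : ℝ} (hpq : p ≤ q)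
    (hθ : ContinuousOn θ (Icc p q))
    (hd : ∀ t ∈ Icc p q, IsSqDet (l t) (Complex.exp (Complex.I * (θ t : ℂ))))
    {R : ℝ → (F →L[ℝ] F)} (hR : ContinuousOn R (Icc p q))
    (hs : ∀ t ∈ Icc p q, (R t : F →ₗ[ℝ] F).IsSymmetric)
    (hl : ∀ t ∈ Icc p q, l t = chart κ (R t)) :
    θ q - θ p = phase κ (R q) - phase κ (R p) := by
  refine sub_eq_sub_of_exp_eq (θ₂ := fun t => phase κ (R t)) hpq hθ (continuousOn_phase κ hR hs)
    fun t ht => ?_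
  have h1 := hd t ht
  rw [hl t ht] at h1
  exact h1.unique (isSqDet_chart (hs t ht))

/-- Computation of the Maslov index of a path in a chart around its only crossing. -/
theorem HasMaslovIndex.eq_sigNeg_sub {l : ℝ → Submodule ℝ (SympSpace F)} {c d : ℝ} {m : ℤ}
    (h : HasMaslovIndex l c d m) {p q κ : ℝ} (hκ : 0 < κ) (hcp : c ≤ p) (hpq : p ≤ q) (hqd : q ≤ d)
    {S R : ℝ → (F →L[ℝ] F)} (hS₁ : ContinuousOn S (Icc c p)) (hS₂ : ContinuousOn S (Icc q d))
    (hSs : ∀ t ∈ Icc c p ∪ Icc q d, (S t : F →ₗ[ℝ] F).IsSymmetric)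
    (hSl : ∀ t ∈ Icc c p ∪ Icc q d, l t = chart 0 (S t))
    (hR : ContinuousOn R (Icc p q)) (hRs : ∀ t ∈ Icc p q, (R t : F →ₗ[ℝ] F).IsSymmetric)
    (hRl : ∀ t ∈ Icc p q, l t = chart κ (R t)) :
    m = (sigNeg (chartForm κ (R q)) : ℤ) - sigNeg (chartForm κ (R p)) := by
  obtain ⟨l', hgap, hlag, hl', htr, hend, θ, hθ, hdet, hm⟩ := h
  have hcd : c ≤ d := hcp.trans (hpq.trans hqd)
  have sub : ∀ {x y : ℝ}, c ≤ x → y ≤ d + 1 → Icc x y ⊆ Icc c (d + 1) := fun hx hy =>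
    Icc_subset_Icc hx hy
  have e1 := sub_eq_phase_sub hcp (hθ.mono (sub le_rfl (by linarith)))
    (fun t ht => hdet t (sub le_rfl (by linarith) ht)) hS₁ (fun t ht => hSs t (Or.inl ht))
    fun t ht => (hl' t ⟨ht.1, ht.2.trans (hpq.trans hqd)⟩).trans (hSl t (Or.inl ht))
  have e2 := sub_eq_phase_sub hpq (hθ.mono (sub hcp (by linarith)))
    (fun t ht => hdet t (sub hcp (by linarith) ht)) hR hRs
    fun t ht => (hl' t ⟨hcp.trans ht.1, ht.2.trans hqd⟩).trans (hRl t ht)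
  have e3 := sub_eq_phase_sub hqd (hθ.mono (sub (hcp.trans hpq) (by linarith)))
    (fun t ht => hdet t (sub (hcp.trans hpq) (by linarith) ht)) hS₂
    (fun t ht => hSs t (Or.inr ht))
    fun t ht => (hl' t ⟨(hcp.trans hpq).trans ht.1, ht.2⟩).trans (hSl t (Or.inr ht))
  have hsub : Icc d (d + 1) ⊆ Icc c (d + 1) := sub hcd le_rfl
  -- The closing path is transverse to `F × 0`, so it stays in the chart `κ = 0` and its phase
  -- varies from that of `S d` to that of `S c`, whichever closing path was chosen.
  obtain ⟨S', hS'c, hS's, hS'l⟩ := exists_chart_zero_of_isCompl (hgap.mono hsub)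
    (fun t ht => hlag t (hsub ht)) htr
  have hd1 : d ≤ d + 1 := by linarith
  have e4 := sub_eq_phase_sub hd1 (hθ.mono hsub) (fun t ht => hdet t (hsub ht)) hS'c hS's hS'l
  have f1 : S' d = S d := chart_zero_injective (by
    rw [← hS'l d (left_mem_Icc.2 hd1), hl' d (right_mem_Icc.2 hcd),
      hSl d (Or.inr (right_mem_Icc.2 hqd))])
  have f2 : S' (d + 1) = S c := chart_zero_injective (by
    rw [← hS'l _ (right_mem_Icc.2 hd1), hend, hSl c (Or.inl (left_mem_Icc.2 hcp))])
  rw [f1, f2] at e4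
  have hp := phase_zero_eq hκ (S := S p) (hRs p (left_mem_Icc.2 hpq))
    ((hRl p (left_mem_Icc.2 hpq)).symm.trans (hSl p (Or.inl (right_mem_Icc.2 hcp))))
  have hq := phase_zero_eq hκ (S := S q) (hRs q (right_mem_Icc.2 hpq))
    ((hRl q (right_mem_Icc.2 hpq)).symm.trans (hSl q (Or.inr (left_mem_Icc.2 hqd))))
  -- In the sum of the four variations the phases of `S c` and `S d` cancel. What remains is the
  -- discrepancy between the two charts at `q` minus the one at `p`.
  have key : 2 * Real.pi * (m : ℝ) =
      2 * Real.pi * ((sigNeg (chartForm κ (R q)) : ℝ) - sigNeg (chartForm κ (R p))) := by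
    rw [← hm]
    linarith
  have h2 := mul_left_cancel₀ (by positivity) key
  exact_mod_cast h2

theorem GapContinuousOn.congr' {l l' : ℝ → Submodule ℝ (SympSpace F)} {s : Set ℝ}
    (h : GapContinuousOn l s) (hl : ∀ t ∈ s, l' t = l t) : GapContinuousOn l' s :=
  ContinuousOn.congr h fun t ht =>
    congrArg (fun M : Submodule ℝ (SympSpace F) => M.topologicalClosure.starProjection) (hl t ht)

theorem continuousOn_ite_Icc {X : Type*} [TopologicalSpace X] {f g : ℝ → X} {c d e : ℝ}
    (hcd : c ≤ d) (hde : d ≤ e) (hf : ContinuousOn f (Icc c d)) (hg : ContinuousOn g (Icc d e))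
    (h : f d = g d) : ContinuousOn (fun t => if t ≤ d then f t else g t) (Icc c e) := by
  have h1 : ContinuousOn (fun t => if t ≤ d then f t else g t) (Icc c d) :=
    hf.congr fun t ht => if_pos ht.2
  have h2 : ContinuousOn (fun t => if t ≤ d then f t else g t) (Icc d e) := by
    refine hg.congr fun t ht => ?_
    rcases ht.1.eq_or_lt with rfl | hlt
    · simp [h]
    · exact if_neg hlt.not_ge
  rw [← Icc_union_Icc_eq_Icc hcd hde]
  exact h1.union_of_isClosed h2 isClosed_Icc isClosed_Icc

/-- A path with transverse endpoints that stays in one chart has a Maslov index. -/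
theorem hasMaslovIndex_of_chart {l : ℝ → Submodule ℝ (SympSpace F)} {c d κ : ℝ} (hκ : 0 < κ)
    (hcd : c ≤ d) {R : ℝ → (F →L[ℝ] F)} (hR : ContinuousOn R (Icc c d))
    (hRs : ∀ t ∈ Icc c d, (R t : F →ₗ[ℝ] F).IsSymmetric)
    (hRl : ∀ t ∈ Icc c d, l t = chart κ (R t)) {S₀ S₁ : F →L[ℝ] F}
    (h₀ : (S₀ : F →ₗ[ℝ] F).IsSymmetric) (h₁ : (S₁ : F →ₗ[ℝ] F).IsSymmetric)
    (hl₀ : l c = chart 0 S₀) (hl₁ : l d = chart 0 S₁) :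
    HasMaslovIndex l c d ((sigNeg (chartForm κ (R d)) : ℤ) - sigNeg (chartForm κ (R c))) := by
  -- The symmetric operators form a vector space, so a segment from `S₁` to `S₀` closes the path
  -- inside the chart `κ = 0`.
  set S : ℝ → (F →L[ℝ] F) := fun t => S₁ + (t - d) • (S₀ - S₁) with hS
  have hSc : Continuous S := by fun_prop
  have hSd : S d = S₁ := by simp [hS]
  have hSe : S (d + 1) = S₀ := by simp [hS]
  have hSs : ∀ t, (S t : F →ₗ[ℝ] F).IsSymmetric := by
    intro t v w
    have e0 : inner ℝ (S₀ v) w = inner ℝ v (S₀ w) := h₀ v w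
    have e1 : inner ℝ (S₁ v) w = inner ℝ v (S₁ w) := h₁ v w
    simp only [hS, ContinuousLinearMap.coe_coe, add_apply, smul_apply, sub_apply, inner_add_left,
      inner_add_right, inner_sub_left, inner_sub_right, real_inner_smul_left,
      real_inner_smul_right, e0, e1]
  have hd1 : d ≤ d + 1 := by linarith
  have hdl : d ∈ Icc c d := right_mem_Icc.2 hcd
  have hcl : c ∈ Icc c d := left_mem_Icc.2 hcd
  have hlS : l d = chart 0 (S d) := by rw [hSd, hl₁]
  set l' : ℝ → Submodule ℝ (SympSpace F) := fun t => if t ≤ d then l t else chart 0 (S t) with hl'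
  have hl'1 : ∀ t ∈ Icc c d, l' t = l t := fun t ht => if_pos ht.2
  have hl'2 : ∀ t ∈ Icc d (d + 1), l' t = chart 0 (S t) := by
    intro t ht
    rcases ht.1.eq_or_lt with rfl | hlt
    · rw [hl'1 _ hdl, hlS]
    · exact if_neg hlt.not_ge
  have hcase : ∀ t ∈ Icc c (d + 1), t ∈ Icc c d ∨ t ∈ Icc d (d + 1) := by
    intro t ht
    rcases le_total t d with h | h
    · exact Or.inl ⟨ht.1, h⟩
    · exact Or.inr ⟨h, ht.2⟩
  have p₀ := phase_zero_eq hκ (S := S₀) (hRs c hcl) ((hRl c hcl).symm.trans hl₀)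
  have p₁ := phase_zero_eq hκ (S := S₁) (hRs d hdl) ((hRl d hdl).symm.trans hl₁)
  set k : ℤ := ((sigNeg (chartForm κ (R d)) : ℕ) : ℤ) with hk
  refine ⟨l', ?_, ?_, hl'1, ?_, ?_, ?_⟩
  · have g1 : GapContinuousOn l' (Icc c d) :=
      (gapContinuousOn_chart (κ := κ) hR).congr' fun t ht => (hl'1 t ht).trans (hRl t ht)
    have g2 : GapContinuousOn l' (Icc d (d + 1)) :=
      (gapContinuousOn_chart hSc.continuousOn).congr' hl'2
    rw [← Icc_union_Icc_eq_Icc hcd hd1]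
    exact ContinuousOn.union_of_isClosed g1 g2 isClosed_Icc isClosed_Icc
  · intro t ht
    rcases hcase t ht with h | h
    · rw [hl'1 t h, hRl t h]
      exact isLagrangian_chart (hRs t h)
    · rw [hl'2 t h]
      exact isLagrangian_chart (hSs t)
  · intro t ht
    rw [hl'2 t ht]
    exact isCompl_chart_zero _
  · rw [hl'2 _ (right_mem_Icc.2 hd1), hSe, hl₀]
  -- The added `2πk` is the discrepancy between the phases of the two charts at `d`; it makes the
  -- argument continuous there.
  · refine ⟨fun t => if t ≤ d then phase κ (R t) else phase 0 (S t) + 2 * Real.pi * k, ?_, ?_, ?_⟩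
    · refine continuousOn_ite_Icc hcd hd1 (continuousOn_phase κ hR hRs)
        ((continuousOn_phase 0 hSc.continuousOn fun t _ => hSs t).add continuousOn_const) ?_
      rw [hSd, p₁, hk]
      push_cast
      ring
    · intro t ht
      by_cases htd : t ≤ d
      · have h : t ∈ Icc c d := ⟨ht.1, htd⟩
        simp only [if_pos htd]
        rw [hl'1 t h, hRl t h]
        exact isSqDet_chart (hRs t h)
      · have h : t ∈ Icc d (d + 1) := ⟨(not_le.1 htd).le, ht.2⟩
        simp only [if_neg htd]
        rw [hl'2 t h]
        have : Complex.I * ((phase 0 (S t) + 2 * Real.pi * k : ℝ) : ℂ) =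
            Complex.I * (phase 0 (S t) : ℂ) + k * (2 * Real.pi * Complex.I) := by
          push_cast; ring
        rw [this, Complex.exp_add, Complex.exp_int_mul_two_pi_mul_I, mul_one]
        exact isSqDet_chart (hSs t)
    · have : ¬ (d + 1 ≤ d) := by linarith
      simp only [if_neg this, if_pos hcd, hSe, p₀]
      push_cast
      ring

/-- The map `j` carries `Q` to the derivative of `1 + κ R` on its kernel, up to the negative factor
`-κ⁻¹`. The signs are thus reversed: positive directions of `Q` become negative ones of `1 + κ R`
after `s`, and negative directions of `Q` give the negative ones before `s`. -/
theorem exists_sigNeg_chartForm {R : ℝ → (F →L[ℝ] F)} {R' : F →L[ℝ] F} {s κ : ℝ} (hκ : 0 < κ)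
    (hR : HasDerivAt R R' s) (hRs : ∀ᶠ t in 𝓝 s, (R t : F →ₗ[ℝ] F).IsSymmetric)
    {V : Type*} [AddCommGroup V] [Module ℝ V] {Q : QuadraticForm ℝ V} (hQ : IsNondegenerate Q)
    {j : V →ₗ[ℝ] F} (hj : Function.Injective j)
    (hrange : LinearMap.range j =
      LinearMap.ker ((ContinuousLinearMap.id ℝ F + κ • R s : F →L[ℝ] F) : F →ₗ[ℝ] F))
    (hform : ∀ u, inner ℝ (R' (j u)) (j u) = -(κ⁻¹ ^ 2) * Q u) :
    ∃ N : ℕ,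
      (∀ᶠ t in 𝓝[>] s, sigNeg (chartForm κ (R t)) = N + sigPos Q ∧
        Function.Injective (ContinuousLinearMap.id ℝ F + κ • R t)) ∧
      (∀ᶠ t in 𝓝[<] s, sigNeg (chartForm κ (R t)) = N + sigNeg Q ∧
        Function.Injective (ContinuousLinearMap.id ℝ F + κ • R t)) := by
  have hfin : FiniteDimensional ℝ V := FiniteDimensional.of_injective j hj
  have hG : HasDerivAt (fun t => ContinuousLinearMap.id ℝ F + κ • R t) (κ • R') s :=
    (hR.fun_const_smul κ).const_add _
  have hGs : ∀ᶠ t in 𝓝 s,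
      ((ContinuousLinearMap.id ℝ F + κ • R t : F →L[ℝ] F) : F →ₗ[ℝ] F).IsSymmetric := by
    filter_upwards [hRs] with t ht v w
    have e : inner ℝ (R t v) w = inner ℝ v (R t w) := ht v w
    simp only [ContinuousLinearMap.coe_coe, add_apply, smul_apply,
      ContinuousLinearMap.id_apply, inner_add_left, inner_add_right, real_inner_smul_left,
      real_inner_smul_right, e]
  have hker : ∀ u, (ContinuousLinearMap.id ℝ F + κ • R s) (j u) = 0 := fun u =>
    LinearMap.mem_ker.1 (hrange ▸ LinearMap.mem_range_self j u)
  have hform' : ∀ u, inner ℝ ((κ • R') (j u)) (j u) = -κ⁻¹ * Q u := by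
    intro u
    rw [smul_apply, real_inner_smul_left, hform]
    field_simp
  obtain ⟨Vp, hVp, hVp'⟩ := exists_finrank_eq_sigPos_and_posDef Q
  obtain ⟨Vn, hVn, hVn'⟩ := exists_finrank_eq_sigNeg_and_negDef Q
  rw [posDef_restrict_iff] at hVp' hVn'
  have hrp : Module.finrank ℝ (Vp.map j) = sigPos Q := by
    rw [← hVp, (Submodule.equivMapOfInjective j hj Vp).finrank_eq]
  have hrn : Module.finrank ℝ (Vn.map j) = sigNeg Q := by
    rw [← hVn, (Submodule.equivMapOfInjective j hj Vn).finrank_eq]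
  have hrad : Q.radical = ⊥ := by
    rw [eq_bot_iff]
    refine QuadraticMap.radical_le_ker_polarBilin.trans ?_
    rw [← LinearMap.separatingLeft_iff_ker_eq_bot.1 hQ]
  -- Nondegeneracy kills the radical of `Q`, so the two definite subspaces have complementary
  -- dimensions in the kernel.
  have hrank : Module.finrank ℝ (Vn.map j) + Module.finrank ℝ (Vp.map j) =
      Module.finrank ℝ (LinearMap.ker
        ((ContinuousLinearMap.id ℝ F + κ • R s : F →L[ℝ] F) : F →ₗ[ℝ] F)) := by
    have e1 := QuadraticForm.sigPos_add_sigNeg_add_radical (Q := Q)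
    rw [hrad, finrank_bot, add_zero] at e1
    rw [hrp, hrn, ← hrange, LinearMap.finrank_range_of_inj hj, ← e1, add_comm]
  have k1 : ∀ k ∈ Vn.map j, (ContinuousLinearMap.id ℝ F + κ • R s) k = 0 := by
    rintro _ ⟨u, -, rfl⟩; exact hker u
  have k2 : ∀ k ∈ Vp.map j, (ContinuousLinearMap.id ℝ F + κ • R s) k = 0 := by
    rintro _ ⟨u, -, rfl⟩; exact hker u
  have hκ' : 0 < κ⁻¹ := inv_pos.2 hκ
  have k1' : ∀ k ∈ Vn.map j, k ≠ 0 → 0 < inner ℝ ((κ • R') k) k := by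
    rintro _ ⟨u, hu, rfl⟩ h0
    have hu0 : u ≠ 0 := by rintro rfl; simp at h0
    have := mul_pos hκ' (hVn' u hu hu0)
    rw [neg_apply] at this
    rw [hform']
    linarith
  have k2' : ∀ k ∈ Vp.map j, k ≠ 0 → inner ℝ ((κ • R') k) k < 0 := by
    rintro _ ⟨u, hu, rfl⟩ h0
    have hu0 : u ≠ 0 := by rintro rfl; simp at h0
    have := mul_pos hκ' (hVp' u hu hu0)
    rw [hform']
    linarith
  refine ⟨sigNeg (chartForm κ (R s)), ?_, ?_⟩
  · rw [← hrp]
    exact eventually_sigNeg_right hG hGs k1 k2 k1' k2' hrank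
  · rw [← hrn]
    exact eventually_sigNeg_left hG hGs k1 k2 k1' k2' hrank

end MaslovCharts

/-! ### The crossing form in the reduced space -/

section Crossing

variable {H : Type*} [NormedAddCommGroup H] [InnerProductSpace ℝ H] [CompleteSpace H]
  {T₀ : H →ₗ.[ℝ] H}

theorem quadForm_apply (B : GraphDomain T₀ →L[ℝ] H) (K : Submodule ℝ (GraphDomain T₀)) (u : K) :
    quadForm B K u = inner ℝ (B u) (inclL T₀ u) := rfl

theorem mem_kernel {B : GraphDomain T₀ →L[ℝ] H} {u : GraphDomain T₀} :
    u ∈ kernel B ↔ B u = 0 := Iff.rfl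

theorem kernel_eq_bot_iff {B : GraphDomain T₀ →L[ℝ] H} : kernel B = ⊥ ↔ Function.Injective B :=
  LinearMap.ker_eq_bot

theorem inverse_pert_of_mem_kernel {B : GraphDomain T₀ →L[ℝ] H} {F : Submodule ℝ H}
    [F.HasOrthogonalProjection] {κ : ℝ} (hκ : κ ≠ 0) (h : (pert B F κ).IsInvertible)
    {u : GraphDomain T₀} (hu : B u = 0) :
    (pert B F κ).inverse (F.orthogonalProjectionOnto (inclL T₀ u) : H) = -κ⁻¹ • u := by
  have h1 : pert B F κ (-κ⁻¹ • u) = (F.orthogonalProjectionOnto (inclL T₀ u) : H) := by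
    rw [map_smul, pert_apply, hu, zero_sub, smul_neg, neg_smul, neg_neg, smul_smul,
      inv_mul_cancel₀ hκ, one_smul]
    rfl
  rw [← h1, h.inverse_apply_self]

/-- The projection to `F` maps `ker B` to the kernel of `1 + κ P_F (B - κ P_F)⁻¹`. -/
theorem apply_orthogonalProjection_of_mem_kernel {B : GraphDomain T₀ →L[ℝ] H} {F : Submodule ℝ H}
    [F.HasOrthogonalProjection] {κ : ℝ} (hκ : κ ≠ 0) (h : (pert B F κ).IsInvertible)
    {u : GraphDomain T₀} (hu : B u = 0) :
    (ContinuousLinearMap.id ℝ F + κ • compression B F κ)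
      (F.orthogonalProjectionOnto (inclL T₀ u)) = 0 := by
  rw [add_apply, smul_apply, ContinuousLinearMap.id_apply, compression_apply,
    inverse_pert_of_mem_kernel hκ h hu, map_smul, map_smul, smul_smul, mul_neg,
    mul_inv_cancel₀ hκ, neg_one_smul, add_neg_cancel]

theorem injective_orthogonalProjection_kernel {B : GraphDomain T₀ →L[ℝ] H} {F : Submodule ℝ H}
    [F.HasOrthogonalProjection] {κ : ℝ} (h : (pert B F κ).IsInvertible)
    {u : GraphDomain T₀} (hu : B u = 0) (h0 : F.orthogonalProjectionOnto (inclL T₀ u) = 0) :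
    u = 0 := by
  refine h.injective (?_ : pert B F κ u = pert B F κ 0)
  have h1 : F.starProjection (inclL T₀ u) = 0 := by
    rw [Submodule.starProjection_apply, h0]; rfl
  rw [pert_apply, hu, h1, map_zero, smul_zero, sub_zero]

/-- The projection embeds `ker B` in the kernel of `1 + κ T`; this carries isolation of the zero
from `F` back to the unbounded operators. -/
theorem injective_of_injective_compression {B : GraphDomain T₀ →L[ℝ] H} {F : Submodule ℝ H}
    [F.HasOrthogonalProjection] {κ : ℝ} (hκ : κ ≠ 0) (h : (pert B F κ).IsInvertible)
    (hinj : Function.Injective (ContinuousLinearMap.id ℝ F + κ • compression B F κ)) :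
    Function.Injective B := by
  rw [injective_iff_map_eq_zero]
  intro u hu
  refine injective_orthogonalProjection_kernel h hu (hinj ?_)
  rw [apply_orthogonalProjection_of_mem_kernel hκ h hu, map_zero]

/-- The projection to `F`, from the kernel of `B`. -/
def kernelProj (B : GraphDomain T₀ →L[ℝ] H) (F : Submodule ℝ H) [F.HasOrthogonalProjection] :
    kernel B →ₗ[ℝ] F :=
  ((F.orthogonalProjectionOnto ∘L inclL T₀ : GraphDomain T₀ →L[ℝ] F) :
    GraphDomain T₀ →ₗ[ℝ] F) ∘ₗ (kernel B).subtype

theorem kernelProj_apply (B : GraphDomain T₀ →L[ℝ] H) (F : Submodule ℝ H)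
    [F.HasOrthogonalProjection] (u : kernel B) :
    kernelProj B F u = F.orthogonalProjectionOnto (inclL T₀ u) := rfl

theorem kernelProj_injective {B : GraphDomain T₀ →L[ℝ] H} {F : Submodule ℝ H}
    [F.HasOrthogonalProjection] {κ : ℝ} (h : (pert B F κ).IsInvertible) :
    Function.Injective (kernelProj B F) := by
  rw [injective_iff_map_eq_zero]
  intro u hu
  exact Subtype.ext (injective_orthogonalProjection_kernel h u.2 hu)

theorem range_kernelProj {B : GraphDomain T₀ →L[ℝ] H} {F : Submodule ℝ H}
    [F.HasOrthogonalProjection] {κ : ℝ} (hκ : κ ≠ 0) (h : (pert B F κ).IsInvertible) :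
    LinearMap.range (kernelProj B F) =
      LinearMap.ker ((ContinuousLinearMap.id ℝ F + κ • compression B F κ : F →L[ℝ] F) :
        F →ₗ[ℝ] F) := by
  ext w
  constructor
  · rintro ⟨u, rfl⟩
    exact apply_orthogonalProjection_of_mem_kernel hκ h u.2
  · intro hw
    have hw' : w + κ • compression B F κ w = 0 := hw
    set x := (pert B F κ).inverse (w : H) with hx
    have h1 : κ • F.orthogonalProjectionOnto (inclL T₀ x) = -w := by
      rw [add_comm] at hw'
      exact eq_neg_of_add_eq_zero_left hw'
    have h2 : B x = 0 := by
      have h3 : B x = w + κ • F.starProjection (inclL T₀ x) := map_inverse_pert h _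
      have h4 : ((κ • F.orthogonalProjectionOnto (inclL T₀ x) : F) : H) = ((-w : F) : H) :=
        congrArg _ h1
      rw [Submodule.coe_smul, Submodule.coe_neg] at h4
      rw [h3, Submodule.starProjection_apply, h4, add_neg_cancel]
    -- The factor `-κ` undoes the relation `κ P x = -w`.
    refine ⟨⟨-κ • x, ?_⟩, ?_⟩
    · rw [mem_kernel, map_smul, h2, smul_zero]
    · rw [kernelProj_apply]
      change F.orthogonalProjectionOnto (inclL T₀ (-κ • x)) = w
      rw [map_smul, map_smul, neg_smul, h1, neg_neg]

theorem eventually_isInvertible_pert [CompleteSpace (GraphDomain T₀)]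
    {A : ℝ → (GraphDomain T₀ →L[ℝ] H)} {s : ℝ} (hA : ContinuousAt A s) (F : Submodule ℝ H)
    [F.HasOrthogonalProjection] {κ : ℝ} (h : (pert (A s) F κ).IsInvertible) :
    ∀ᶠ t in 𝓝 s, (pert (A t) F κ).IsInvertible :=
  eventually_isInvertible (X := GraphDomain T₀) (Y := H) (M := fun t => pert (A t) F κ)
    (ContinuousAt.sub hA continuousAt_const) h

/-- The jump, at a nondegenerate crossing, of the negative index that computes the change of
chart. -/
theorem eventually_sigNeg_compression [CompleteSpace (GraphDomain T₀)]
    {A : ℝ → (GraphDomain T₀ →L[ℝ] H)} {A' : GraphDomain T₀ →L[ℝ] H} {s : ℝ}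
    (hA : HasDerivAt A A' s) (hsa : ∀ᶠ t in 𝓝 s, IsSelfAdjoint (toUnbounded (A t)))
    (hQ : IsNondegenerate (quadForm A' (kernel (A s)))) (F : Submodule ℝ H)
    [FiniteDimensional ℝ F] [F.HasOrthogonalProjection] {κ : ℝ} (hκ : 0 < κ)
    (h : (pert (A s) F κ).IsInvertible) :
    ∃ N : ℕ,
      (∀ᶠ t in 𝓝[>] s, sigNeg (chartForm κ (compression (A t) F κ)) =
        N + sigPos (quadForm A' (kernel (A s))) ∧ Function.Injective (A t)) ∧
      (∀ᶠ t in 𝓝[<] s, sigNeg (chartForm κ (compression (A t) F κ)) =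
        N + sigNeg (quadForm A' (kernel (A s))) ∧ Function.Injective (A t)) := by
  have hinv := eventually_isInvertible_pert
    (HasDerivAt.continuousAt (F := GraphDomain T₀ →L[ℝ] H) hA) F h
  have hsym : ∀ᶠ t in 𝓝 s, (compression (A t) F κ : F →ₗ[ℝ] F).IsSymmetric := by
    filter_upwards [hinv, hsa] with t ht1 ht2 using isSymmetric_compression ht2 F ht1
  -- On the projection of `u ∈ ker (A s)` the inverse of the perturbation returns `-κ⁻¹ u`. It
  -- occurs twice in the form, whence `κ⁻¹ ^ 2`.
  have hform : ∀ u : kernel (A s), inner ℝ (((F.orthogonalProjectionOnto ∘L inclL T₀) ∘L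
      (-((pert (A s) F κ).inverse ∘L A' ∘L (pert (A s) F κ).inverse)) ∘L F.subtypeL)
        (kernelProj (A s) F u)) (kernelProj (A s) F u) =
      -(κ⁻¹ ^ 2) * quadForm A' (kernel (A s)) u := by
    intro u
    rw [inner_deriv_compression hsa.self_of_nhds A' F h, kernelProj_apply,
      inverse_pert_of_mem_kernel hκ.ne' h u.2, map_smul, map_smul,
      real_inner_smul_left, real_inner_smul_right, quadForm_apply]
    ring
  obtain ⟨N, hr, hl⟩ := exists_sigNeg_chartForm hκ (hasDerivAt_compression hA F h) hsym hQ
    (kernelProj_injective h) (range_kernelProj hκ.ne' h) hform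
  refine ⟨N, ?_, ?_⟩
  · filter_upwards [hr, hinv.filter_mono nhdsWithin_le_nhds] with t ht1 ht2
    exact ⟨ht1.1, injective_of_injective_compression hκ.ne' ht2 ht1.2⟩
  · filter_upwards [hl, hinv.filter_mono nhdsWithin_le_nhds] with t ht1 ht2
    exact ⟨ht1.1, injective_of_injective_compression hκ.ne' ht2 ht1.2⟩

/-- If `B u = κ P u`, this vector lies both in the range of `B` and in its kernel `F`, which are
orthogonal; so `P u = 0` and `B u = 0`. Then `u ∈ F`, and `u = P u = 0`. -/
theorem injective_pert_kernel {B : GraphDomain T₀ →L[ℝ] H}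
    (hB : IsSelfAdjoint (toUnbounded B)) (F : Submodule ℝ H) [F.HasOrthogonalProjection]
    (hF : F = (kernel B).map (inclL T₀ : GraphDomain T₀ →ₗ[ℝ] H)) {κ : ℝ} (hκ : κ ≠ 0) :
    Function.Injective (pert B F κ) := by
  rw [injective_iff_map_eq_zero]
  intro u hu
  rw [pert_apply, sub_eq_zero] at hu
  have h1 : F.starProjection (inclL T₀ u) = 0 := by
    refine (inner_self_eq_zero (𝕜 := ℝ)).1 ?_
    have h2 : F.starProjection (inclL T₀ u) ∈
        (kernel B).map (inclL T₀ : GraphDomain T₀ →ₗ[ℝ] H) :=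
      hF ▸ Submodule.starProjection_apply_mem F _
    obtain ⟨v, hv, hv'⟩ := h2
    have h3 := inner_map_left hB u v
    have hv0 : B v = 0 := hv
    have hv'' : inclL T₀ v = F.starProjection (inclL T₀ u) := hv'
    rw [hu, hv0, inner_zero_right, real_inner_smul_left, hv''] at h3
    exact (mul_eq_zero.1 h3).resolve_left hκ
  have h2 : B u = 0 := by rw [hu, h1, smul_zero]
  have h3 : inclL T₀ u ∈ F := hF ▸ ⟨u, h2, rfl⟩
  rw [Submodule.starProjection_eq_self_iff.2 h3] at h1
  exact inclL_injective T₀ (h1.trans (map_zero _).symm)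

end Crossing

/-! ### Existence and uniqueness of the spectral flow near the crossing -/

section SpectralFlow

variable {H : Type*} [NormedAddCommGroup H] [InnerProductSpace ℝ H] [CompleteSpace H]
  {T₀ : H →ₗ.[ℝ] H}

theorem finiteDimensional_orthogonal {I : Submodule ℝ H} (hI : IsClosed (I : Set H))
    (hfin : FiniteDimensional ℝ (H ⧸ I)) : FiniteDimensional ℝ Iᗮ := by
  have : CompleteSpace I := hI.completeSpace_coe
  exact LinearEquiv.finiteDimensional
    (Submodule.quotientEquivOfIsCompl I Iᗮ I.isCompl_orthogonal)

theorem eventually_forall_Icc {P : ℝ → Prop} {s : ℝ} (h : ∀ᶠ t in 𝓝 s, P t) :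
    ∀ᶠ ε in 𝓝[>] (0 : ℝ), ∀ t ∈ Icc (s - ε) (s + ε), P t := by
  obtain ⟨δ, hδ, h⟩ := Metric.eventually_nhds_iff.1 h
  filter_upwards [Ioo_mem_nhdsGT hδ] with ε hε t ht
  refine h ?_
  rw [Real.dist_eq, abs_lt]
  constructor <;> linarith [ht.1, ht.2, hε.2]

theorem tendsto_sub_nhdsLT (s : ℝ) : Tendsto (fun ε => s - ε) (𝓝[>] 0) (𝓝[<] s) := by
  refine tendsto_nhdsWithin_iff.2 ⟨?_, ?_⟩
  · have : Tendsto (fun ε : ℝ => s - ε) (𝓝 0) (𝓝 (s - 0)) :=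
      (continuous_const.sub continuous_id).tendsto 0
    rw [sub_zero] at this
    exact this.mono_left nhdsWithin_le_nhds
  · filter_upwards [self_mem_nhdsWithin] with ε hε
    exact sub_lt_self s hε

theorem tendsto_add_nhdsGT (s : ℝ) : Tendsto (fun ε => s + ε) (𝓝[>] 0) (𝓝[>] s) := by
  refine tendsto_nhdsWithin_iff.2 ⟨?_, ?_⟩
  · have : Tendsto (fun ε : ℝ => s + ε) (𝓝 0) (𝓝 (s + 0)) :=
      (continuous_const.add continuous_id).tendsto 0
    rw [add_zero] at this
    exact this.mono_left nhdsWithin_le_nhds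
  · filter_upwards [self_mem_nhdsWithin] with ε hε
    exact lt_add_of_pos_right s hε

theorem isInvertible_pert_zero {B : GraphDomain T₀ →L[ℝ] H} (h : B.IsInvertible)
    (F : Submodule ℝ H) [F.HasOrthogonalProjection] : (pert B F 0).IsInvertible := by
  rwa [pert_zero]

/-- The spectral flow across a single nondegenerate crossing can only be the signature of the
crossing form. -/
theorem HasSpectralFlow.eq_signature [CompleteSpace (GraphDomain T₀)]
    {A : ℝ → (GraphDomain T₀ →L[ℝ] H)} {A' : GraphDomain T₀ →L[ℝ] H} {s c d : ℝ} {m : ℤ}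
    (hA : HasDerivAt A A' s) (hcs : c < s) (hsd : s < d) (hcont : ContinuousOn A (Icc c d))
    (hsa : ∀ t ∈ Icc c d, IsSelfAdjoint (toUnbounded (A t)))
    (hF : ∀ t ∈ Icc c d, IsFredholmOp (toUnbounded (A t)))
    (hinj : ∀ t ∈ Icc c d, t ≠ s → Function.Injective (A t))
    (hQ : IsNondegenerate (quadForm A' (kernel (A s))))
    (h : HasSpectralFlow (fun t => toUnbounded (A t)) c d m) :
    m = signature (quadForm A' (kernel (A s))) := by
  obtain ⟨-, I, hI, hIfin, hclean, hmas⟩ := h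
  have hfin : FiniteDimensional ℝ Iᗮ := finiteDimensional_orthogonal hI hIfin
  have hs : s ∈ Icc c d := ⟨hcs.le, hsd.le⟩
  have hnhds : Icc c d ∈ 𝓝 s := Icc_mem_nhds hcs hsd
  -- The subspace `I` is imposed by the given spectral flow, so `κ` has to be adapted to it.
  obtain ⟨κ, hκ, hκi⟩ := exists_pos_injective_pert (hsa s hs) hI (hclean s hs)
  have hinv := isInvertible_pert (hsa s hs) (hF s hs) Iᗮ hκi
  obtain ⟨N, hr, hl⟩ := eventually_sigNeg_compression hA
    (by filter_upwards [hnhds] with t ht using hsa t ht) hQ Iᗮ hκ hinv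
  have hev := eventually_isInvertible_pert
    (HasDerivAt.continuousAt (F := GraphDomain T₀ →L[ℝ] H) hA) Iᗮ hinv
  -- Only `[s - δ, s + δ]` is known to lie in the chart `κ`; on the rest of `[c, d]` the operators
  -- are invertible and the chart `0` is available.
  obtain ⟨δ, hδN, hδP, hδr, hδl, hδ0⟩ := ((eventually_forall_Icc hnhds).and
    ((eventually_forall_Icc hev).and (((tendsto_add_nhdsGT s).eventually hr).and
    (((tendsto_sub_nhdsLT s).eventually hl).and self_mem_nhdsWithin)))).exists
  have hδ : 0 < δ := hδ0
  have hcp : c ≤ s - δ := (hδN (s - δ) ⟨le_rfl, by linarith⟩).1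
  have hqd : s + δ ≤ d := (hδN (s + δ) ⟨by linarith, le_rfl⟩).2
  have hA0 : ∀ t ∈ Icc c (s - δ) ∪ Icc (s + δ) d, t ∈ Icc c d ∧ (A t).IsInvertible := by
    intro t ht
    have h1 : t ∈ Icc c d ∧ t ≠ s := by
      rcases ht with ht | ht
      · exact ⟨⟨ht.1, by linarith [ht.2]⟩, by linarith [ht.2] |> fun h : t < s => h.ne⟩
      · exact ⟨⟨by linarith [ht.1], ht.2⟩, by linarith [ht.1] |> fun h : s < t => h.ne'⟩
    exact ⟨h1.1, isInvertible_of_injective (hsa t h1.1) (hF t h1.1) (hinj t h1.1 h1.2)⟩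
  have key := hmas.eq_sigNeg_sub hκ hcp (by linarith) hqd
    (S := fun t => compression (A t) Iᗮ 0) (R := fun t => compression (A t) Iᗮ κ)
    (continuousOn_compression (hcont.mono fun t ht => (hA0 t (Or.inl ht)).1) Iᗮ
      fun t ht => isInvertible_pert_zero (hA0 t (Or.inl ht)).2 Iᗮ)
    (continuousOn_compression (hcont.mono fun t ht => (hA0 t (Or.inr ht)).1) Iᗮ
      fun t ht => isInvertible_pert_zero (hA0 t (Or.inr ht)).2 Iᗮ)
    (fun t ht => isSymmetric_compression (hsa t (hA0 t ht).1) Iᗮ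
      (isInvertible_pert_zero (hA0 t ht).2 Iᗮ))
    (fun t ht => reduction_graphS (isInvertible_pert_zero (hA0 t ht).2 Iᗮ))
    (continuousOn_compression (hcont.mono hδN) Iᗮ hδP)
    (fun t ht => isSymmetric_compression (hsa t (hδN t ht)) Iᗮ (hδP t ht))
    (fun t ht => reduction_graphS (hδP t ht))
  rw [key, hδr.1, hδl.1, signature]
  push_cast
  ring

/-- A single pair `(I, κ)` valid on the whole interval gives cleanness and keeps the reduced path in
one chart; invertibility at the ends puts the endpoints in the chart `0`. -/
theorem hasSpectralFlow_of_isInvertible_pert [CompleteSpace (GraphDomain T₀)]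
    {A : ℝ → (GraphDomain T₀ →L[ℝ] H)} {c d κ : ℝ} (hκ : 0 < κ) (hcd : c ≤ d)
    (hcont : ContinuousOn A (Icc c d))
    (hsa : ∀ t ∈ Icc c d, IsSelfAdjoint (toUnbounded (A t)))
    (hF : ∀ t ∈ Icc c d, IsFredholmOp (toUnbounded (A t)))
    (hc : (A c).IsInvertible) (hd : (A d).IsInvertible)
    {I : Submodule ℝ H} (hI : IsClosed (I : Set H)) (hfin : FiniteDimensional ℝ Iᗮ)
    (hinv : ∀ t ∈ Icc c d, (pert (A t) Iᗮ κ).IsInvertible) :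
    HasSpectralFlow (fun t => toUnbounded (A t)) c d
      ((sigNeg (chartForm κ (compression (A d) Iᗮ κ)) : ℤ) -
        sigNeg (chartForm κ (compression (A c) Iᗮ κ))) := by
  have hIc : CompleteSpace I := hI.completeSpace_coe
  have hcl : c ∈ Icc c d := left_mem_Icc.2 hcd
  have hdl : d ∈ Icc c d := right_mem_Icc.2 hcd
  refine ⟨⟨hcd, fun t ht => isLagrangian_graphS (hsa t ht),
    fun t ht => isFredholmPair_graphS (hF t ht), gapContinuousOn_graphS hcont hsa,
    isCompl_graphS hc.bijective, isCompl_graphS hd.bijective⟩, I, hI, ?_,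
    fun t ht => isClean_graphS hI (hinv t ht), ?_⟩
  · exact LinearEquiv.finiteDimensional (Submodule.quotientEquivOfIsCompl I Iᗮ
      I.isCompl_orthogonal).symm
  · exact hasMaslovIndex_of_chart hκ hcd (R := fun t => compression (A t) Iᗮ κ)
      (continuousOn_compression hcont Iᗮ hinv)
      (fun t ht => isSymmetric_compression (hsa t ht) Iᗮ (hinv t ht))
      (fun t ht => reduction_graphS (hinv t ht))
      (isSymmetric_compression (hsa c hcl) Iᗮ (isInvertible_pert_zero hc Iᗮ))
      (isSymmetric_compression (hsa d hdl) Iᗮ (isInvertible_pert_zero hd Iᗮ))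
      (reduction_graphS (isInvertible_pert_zero hc Iᗮ))
      (reduction_graphS (isInvertible_pert_zero hd Iᗮ))

theorem HasBoundedInverse.injective {B : GraphDomain T₀ →L[ℝ] H}
    (h : HasBoundedInverse (toUnbounded B)) : Function.Injective B := by
  obtain ⟨R, hR, -⟩ := h
  intro u v huv
  refine inclL_injective T₀ ?_
  have hu : R (B u) = inclL T₀ u := hR u
  have hv : R (B v) = inclL T₀ v := hR v
  rw [← hu, ← hv, huv]

end SpectralFlow

end SpecFlow

end

/-! ### The main theorem -/

theorem proposition3 {H : Type*} [NormedAddCommGroup H] [InnerProductSpace ℝ H] [CompleteSpace H]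
    [TopologicalSpace.SeparableSpace H] (T₀ : H →ₗ.[ℝ] H)
    (A : ℝ → (SpecFlow.GraphDomain T₀ →L[ℝ] H)) (a b : ℝ)
    (hA : SpecFlow.IsAdmissiblePath T₀ A a b) (hC1 : ContDiffOn ℝ 1 A (Icc a b))
    (s : ℝ) (hs : s ∈ SpecFlow.singularSet A a b)
    (hQ : SpecFlow.IsNondegenerate (SpecFlow.crossingForm A a b s)) :
    (∀ᶠ t in 𝓝[≠] s, t ∉ SpecFlow.singularSet A a b) ∧
    (∀ᶠ ε in 𝓝[>] (0 : ℝ), ∃! m : ℤ,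
      SpecFlow.HasSpectralFlow (fun t => SpecFlow.toUnbounded (A t)) (s - ε) (s + ε) m) ∧
    Tendsto (fun ε : ℝ =>
        SpecFlow.spectralFlow (fun t => SpecFlow.toUnbounded (A t)) (s - ε) (s + ε))
      (𝓝[>] 0) (𝓝 (SpecFlow.signature (SpecFlow.crossingForm A a b s))) := by
  obtain ⟨hsI, hker⟩ := hs
  have hab := hA.lt.le
  have hcomp : CompleteSpace (SpecFlow.GraphDomain T₀) :=
    SpecFlow.completeSpace_graphDomain hA.initial (hA.isSelfAdjoint a (left_mem_Icc.2 hab))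
  rw [Ne, SpecFlow.kernel_eq_bot_iff] at hker
  -- The operators at `a` and `b` are injective, so the crossing is interior and the derivative
  -- within `[a, b]` is a two-sided one.
  have has : a < s := lt_of_le_of_ne hsI.1 fun h => hker (h ▸ hA.inverse_left.injective)
  have hsb : s < b := lt_of_le_of_ne hsI.2 fun h => hker (h ▸ hA.inverse_right.injective)
  have hnhds : Icc a b ∈ 𝓝 s := Icc_mem_nhds has hsb
  have hsa := hA.isSelfAdjoint s hsI
  have hF := hA.isFredholm s hsI
  set A' := derivWithin A (Icc a b) s with hA'
  have hderiv : HasDerivAt A A' s := by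
    have h1 : DifferentiableWithinAt ℝ A (Icc a b) s := hC1.differentiableOn one_ne_zero s hsI
    exact HasDerivWithinAt.hasDerivAt (F := SpecFlow.GraphDomain T₀ →L[ℝ] H)
      (DifferentiableWithinAt.hasDerivWithinAt (F := SpecFlow.GraphDomain T₀ →L[ℝ] H) h1) hnhds
  have hcont : ContinuousAt A s :=
    HasDerivAt.continuousAt (F := SpecFlow.GraphDomain T₀ →L[ℝ] H) hderiv
  have hQ' : SpecFlow.IsNondegenerate (SpecFlow.quadForm A' (SpecFlow.kernel (A s))) := hQ
  set F : Submodule ℝ H := (SpecFlow.kernel (A s)).map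
    (SpecFlow.inclL T₀ : SpecFlow.GraphDomain T₀ →ₗ[ℝ] H) with hFdef
  have hkfin : FiniteDimensional ℝ (SpecFlow.kernel (A s)) := hF.1
  have hFfin : FiniteDimensional ℝ F := Module.Finite.map _ _
  -- The reduction is taken modulo `I = Fᗮ`, whose orthogonal complement is written `Fᗮᗮ`.
  have hFF : Fᗮᗮ = F := Submodule.orthogonal_orthogonal F
  have hFfin' : FiniteDimensional ℝ Fᗮᗮ := hFF.symm ▸ hFfin
  have hinv := SpecFlow.isInvertible_pert hsa hF Fᗮᗮ
    (SpecFlow.injective_pert_kernel hsa Fᗮᗮ hFF one_ne_zero)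
  have hev := SpecFlow.eventually_isInvertible_pert hcont Fᗮᗮ hinv
  obtain ⟨N, hr, hl⟩ := SpecFlow.eventually_sigNeg_compression hderiv
    (by filter_upwards [hnhds] with t ht using hA.isSelfAdjoint t ht) hQ' Fᗮᗮ one_pos hinv
  have hinj : ∀ᶠ t in 𝓝[≠] s, Function.Injective (A t) := by
    rw [← nhdsLT_sup_nhdsGT, eventually_sup]
    exact ⟨hl.mono fun t ht => ht.2, hr.mono fun t ht => ht.2⟩
  have hflow : ∀ᶠ ε in 𝓝[>] (0 : ℝ), ∀ m : ℤ,
      SpecFlow.HasSpectralFlow (fun t => SpecFlow.toUnbounded (A t)) (s - ε) (s + ε) m ↔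
        m = SpecFlow.signature (SpecFlow.crossingForm A a b s) := by
    filter_upwards [SpecFlow.eventually_forall_Icc hnhds, SpecFlow.eventually_forall_Icc hev,
      SpecFlow.eventually_forall_Icc (eventually_nhdsWithin_iff.1 hinj),
      (SpecFlow.tendsto_add_nhdsGT s).eventually hr,
      (SpecFlow.tendsto_sub_nhdsLT s).eventually hl, self_mem_nhdsWithin]
      with ε hε hεP hεi hεr hεl hε0 m
    have hpos : 0 < ε := hε0
    have hcs : s - ε < s := by linarith
    have hsd : s < s + ε := by linarith
    have h1 : ∀ m : ℤ, SpecFlow.HasSpectralFlow (fun t => SpecFlow.toUnbounded (A t))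
        (s - ε) (s + ε) m → m = SpecFlow.signature (SpecFlow.crossingForm A a b s) := fun m h =>
      h.eq_signature hderiv hcs hsd (hA.continuousOn.mono hε)
        (fun t ht => hA.isSelfAdjoint t (hε t ht)) (fun t ht => hA.isFredholm t (hε t ht))
        (fun t ht hts => hεi t ht hts) hQ'
    have hcl : s - ε ∈ Icc (s - ε) (s + ε) := left_mem_Icc.2 (hcs.trans hsd).le
    have hdl : s + ε ∈ Icc (s - ε) (s + ε) := right_mem_Icc.2 (hcs.trans hsd).le
    have h2 := SpecFlow.hasSpectralFlow_of_isInvertible_pert one_pos (hcs.trans hsd).le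
      (hA.continuousOn.mono hε) (fun t ht => hA.isSelfAdjoint t (hε t ht))
      (fun t ht => hA.isFredholm t (hε t ht))
      (SpecFlow.isInvertible_of_injective (hA.isSelfAdjoint _ (hε _ hcl))
        (hA.isFredholm _ (hε _ hcl)) hεl.2)
      (SpecFlow.isInvertible_of_injective (hA.isSelfAdjoint _ (hε _ hdl))
        (hA.isFredholm _ (hε _ hdl)) hεr.2)
      (Submodule.isClosed_orthogonal F) hFfin' hεP
    refine ⟨h1 m, ?_⟩
    rintro rfl
    -- The explicit difference of negative indices is a spectral flow, and the uniqueness part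
    -- identifies it with the signature.
    rwa [h1 _ h2] at h2
  refine ⟨?_, ?_, ?_⟩
  · filter_upwards [hinj] with t ht hts
    exact hts.2 (SpecFlow.kernel_eq_bot_iff.2 ht)
  · filter_upwards [hflow] with ε hε
    exact ⟨_, (hε _).2 rfl, fun m hm => (hε m).1 hm⟩
  -- For small `ε` the spectral flow exists, so the default value `0` is not taken, and it is
  -- constant in `ε`.
  · refine tendsto_const_nhds.congr' ?_
    filter_upwards [hflow] with ε hε
    have hex : ∃ m, SpecFlow.HasSpectralFlow (fun t => SpecFlow.toUnbounded (A t))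
        (s - ε) (s + ε) m := ⟨_, (hε _).2 rfl⟩
    rw [SpecFlow.spectralFlow, dif_pos hex]
    exact ((hε _).1 hex.choose_spec).symm
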